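/- Let $(X,d,\nu)$ be a computable metric space, i.e. $(X,d)$ is a metric space with a dense sequence $\nu:\mathbb N\to X$ such that the reals $d(\nu(i),\nu(j))$ are computable uniformly in $i,j$. Names are elements of $\mathbb N^{\mathbb N}$; $\langle\cdot,\dots\rangle$ denotes the standard computable tuplings of numbers and of (finitely or countably many) names. For representations $\delta,\delta'$ of sets contained in a common set, $\delta\le\delta'$ means that some computable $F:\subseteq\mathbb N^{\mathbb N}\to\mathbb N^{\mathbb N}$ maps every $\delta$-name of a point to a $\delta'$-name of the same point; $\delta|^{S}$ is the restriction of $\delta$ to the names of elements of $S$; a $(\delta\sqcap\delta')$-name of $y$ is a pair $\langle p,q\rangle$ of a $\delta$-name $p$ and a $\delta'$-name $q$ of $y$. Fix standard numberings $\nu_{\mathbb Q}$ of $\mathbb Q$ and $\nu_{\mathbb Q^+}$ of the positive rationals; let $\alpha\langle a,r\rangle=B(\nu(a);\nu_{\mathbb Q^+}(r))$, $\alpha'(0)=\emptyset$ and $\alpha'(n+1)=\alpha(n)$. A $\delta_X$-name of $x\in X$ is a $p$ with $d(\nu(p_i),\nu(p_j))<2^{-\min\{i,j\}}$ for all $i,j$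 and $\nu(p_i)\to x$. A $\delta_{\Sigma^0_1}$-name of an open set $U$ is a $p$ with $U=\bigcup_i\alpha'(p_i)$. Let $\mathcal A(X)$ be the class of closed subsets of $X$ and $\mathcal A'=\mathcal A(X)\setminus\{\emptyset,X\}$. The following are representations of closed sets $A$. * A $\delta_{\Pi^0_1}$-name of $A$ is a $\delta_{\Sigma^0_1}$-name of $X\setminus A$. * A $\delta_{\mathrm{range}}$-name of $A\ne\emptyset$ is a tuple $\langle p^{(0)},p^{(1)},\dots\rangle$ such that all entries of all $p^{(i)}$ are positive and the sequences $p^{(i)}-1$ (entrywise) are $\delta_X$-names of points that form a dense subset of $A$; the only $\delta_{\mathrm{range}}$-name of $\emptyset$ is $0^\omega$. * A $\delta_{\mathrm{dist}}^{>}$-name of $A$ is a $p$ such that $\eta_p$ maps each $\delta_X$-name of each $x\in X$ to some $q$ with $\{n:\nu_{\mathbb Q}(n)<d(x,A)\}=\{q_i-1: q_i\ge 1\}$, where $d(x,\emptyset)=\infty$ and $\eta$ is the canonical representation of the continuous partial functions $\subseteq\mathbb N^{\mathbb N}\to\mathbb N^{\mathbb N}$ with $G_\delta$ domain. * A Dugundji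 system for $A\neq\emptyset$ (with coefficient $2$) consists of open sets $(V_i)_{i\in\mathbb N}$ and points $(y_i)_{i\in\mathbb N}$ of $A$ such that $\bigcup_iV_i=X\setminus A$, each point of $\bigcup_i V_i$ has a neighbourhood meeting only finitely many $V_j$, $d(x,y_i)\le 2\,d(x,A)$ for all $i$ and $x\in V_i$, and for every sequence $(n_i)_i$ in $\mathbb N$, $d(V_{n_i},A)\to0$ implies $\operatorname{diam}V_{n_i}\to0$. A $\delta_4$-name of $A$ is a name $\langle\langle p,q,r\rangle,s\rangle$ for which there is a Dugundji system $((V_i)_i,(y_i)_i)$ for $A$ such that $p=\langle p^{(0)},\dots\rangle$ with $p^{(i)}$ a $\delta_{\Sigma^0_1}$-name of $V_i$ for each $i$; $\bigcup_iV_i=\bigcup_i\alpha'(q_i)$; for each $i$, $\{j: V_j\cap\alpha'(q_i)\ne\emptyset\}$ is contained in the finite set with binary code $r_i$; and $s=\langle s^{(0)},\dots\rangle$ with $s^{(i)}$ a $\delta_X$-name of $y_i$ for each $i$. * A $\delta_8$-name of $A\ne\emptyset$ is a pair $\langle p,q\rangle$ such that $p$ is a $\delta_{\mathrm{range}}$-name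 of some closed set $B$ with $\partial A\subseteq B\subseteq A$, and $q$ is a $\delta_{\Pi^0_1}$-name of $A$. Then $$(\delta_{\mathrm{range}}\sqcap\delta_{\mathrm{dist}}^{>})|^{\mathcal A'}\;\le\;\delta_4|^{\mathcal A'}\;\le\;\delta_8|^{\mathcal A'}.$$ -/

import Mathlib

open TopologicalSpace Filter Topology

namespace Dugundji

/-! Baire space, tuplings, and computable partial functions on it -/

/-- Baire space, the set of names. -/
abbrev Baire : Type := ℕ → ℕ

/-- The word formed by the first `n` entries of `p`. -/
def word (p : Baire) (n : ℕ) : List ℕ := (List.range n).map p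

/-- A partial function on Baire space is (Type-2) computable if it is the limit `h_ω` of a
computable prefix-monotone word function `h`: reading longer and longer prefixes of `p`, one
writes longer and longer prefixes of `F p`, and `F p` is defined exactly when the output written
is infinite. -/
def IsComputable (F : Baire →. Baire) : Prop :=
  ∃ h : List ℕ → List ℕ, Computable h ∧ (∀ u v, u <+: v → h u <+: h v) ∧
    ∀ p q, q ∈ F p ↔ ∀ n, ∃ k, word q n <+: h (word p k)

/-- The components of a pair `⟨p⁽⁰⁾, p⁽¹⁾⟩` (interleaving), `j < 2`. -/
def proj2 (s : Baire) (j : ℕ) : Baire := fun n => s (2 * n + j)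

/-- The components of a triple `⟨p⁽⁰⁾, p⁽¹⁾, p⁽²⁾⟩` (interleaving), `j < 3`. -/
def proj3 (s : Baire) (j : ℕ) : Baire := fun n => s (3 * n + j)

/-- The components of an infinite tuple `s = ⟨p⁽⁰⁾, p⁽¹⁾, …⟩`, where `s ⟨j, k⟩ = p⁽ʲ⁾ k`. -/
def projω (s : Baire) (j : ℕ) : Baire := fun k => s (Nat.pair j k)

/-- The canonical representation `η` of the continuous partial functions on Baire space with
`G_δ` domain, by Kleene associates: the value `η_p(q)(n)` is `m` if the first nonzero number among
`p ⟨n, q↾0⟩, p ⟨n, q↾1⟩, …` exists and equals `m + 1`. -/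
def eta (p : Baire) : Baire →. Baire := fun q =>
  ⟨∀ n, ∃ k, p (Nat.pair n (Encodable.encode (word q k))) ≠ 0,
   fun h n => p (Nat.pair n (Encodable.encode (word q (Nat.find (h n))))) - 1⟩

/-! Representations -/

/-- A representation `δ :⊆ ℕ^ℕ → Y`, given by its graph: `δ p y` says that `p` is a
`δ`-name of `y`. -/
abbrev Rep (Y : Type*) := Baire → Y → Prop

/-- Reducibility `δ ≤ δ'`: some computable partial function turns every `δ`-name of a point into
a `δ'`-name of the same point. -/
def Rep.Reducible {Y : Type*} (δ δ' : Rep Y) : Prop :=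
  ∃ F : Baire →. Baire, IsComputable F ∧ ∀ p y, δ p y → ∃ q ∈ F p, δ' q y

/-- The restriction `δ|^S` of a representation to the names of elements of `S`. -/
def Rep.restrict {Y : Type*} (δ : Rep Y) (S : Set Y) : Rep Y := fun p y => y ∈ S ∧ δ p y

/-- The meet `δ ⊓ δ'`: a name is a pair of a `δ`-name and a `δ'`-name. -/
def Rep.meet {Y : Type*} (δ δ' : Rep Y) : Rep Y := fun s y => δ (proj2 s 0) y ∧ δ' (proj2 s 1) y

/-- The representation `δ^ω` of sequences. -/
def Rep.seq {Y : Type*} (δ : Rep Y) : Rep (ℕ → Y) := fun s y => ∀ i, δ (projω s i) (y i)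

/-- The representation `δ ∘ P`, where `P` subtracts `1` from each entry of a sequence of positive
numbers and is undefined elsewhere. -/
def Rep.shift {Y : Type*} (δ : Rep Y) : Rep Y := fun s y => ∃ p, (∀ k, s k = p k + 1) ∧ δ p y

/-- `G` is a `(δ, δ')`-realizer of the total function `f`. -/
def Realizes {Y Z : Type*} (δ : Rep Y) (δ' : Rep Z) (G : Baire →. Baire) (f : Y → Z) : Prop :=
  ∀ p y, δ p y → ∃ q ∈ G p, δ' q (f y)

/-! Rational numbers and the extended reals -/

/-- The standard numbering of the positive rationals, `⟨a, b⟩ ↦ (a + 1) / (b + 1)`. -/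
def nuQpos (n : ℕ) : ℚ := ((n.unpair.1 : ℚ) + 1) / ((n.unpair.2 : ℚ) + 1)

/-- The standard numbering of the rationals, `⟨⟨a, b⟩, c⟩ ↦ (a - b) / (c + 1)`. -/
def nuQ (n : ℕ) : ℚ :=
  ((n.unpair.1.unpair.1 : ℚ) - (n.unpair.1.unpair.2 : ℚ)) / ((n.unpair.2 : ℚ) + 1)

/-- The representation of the extended reals by enumeration of all smaller rationals (an entry `0`
carries no information, an entry `n + 1` lists the rational number with index `n`). -/
def rhoLower : Rep EReal := fun p t => {n | ((nuQ n : ℝ) : EReal) < t} = {n | ∃ i, p i = n + 1}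

/-! Computable metric spaces and their hyperspaces -/

section Metric

variable {X : Type*} [MetricSpace X]

/-- `(X, d, ν)` is a computable metric space: `ν` is a dense sequence, and the reals `d(ν i, ν j)`
are computable uniformly in `i` and `j`. -/
def IsComputableMetricSpace (ν : ℕ → X) : Prop :=
  DenseRange ν ∧ ∃ f : ℕ × ℕ × ℕ → ℕ, Computable f ∧
    ∀ i j k, |dist (ν i) (ν j) - (nuQ (f (i, j, k)) : ℝ)| < (2 : ℝ)⁻¹ ^ k

/-- The Cauchy representation of `X`. -/
def cauchyRep (ν : ℕ → X) : Rep X := fun p x =>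
  (∀ i j, dist (ν (p i)) (ν (p j)) < (2 : ℝ)⁻¹ ^ min i j) ∧
    Tendsto (fun i => ν (p i)) atTop (𝓝 x)

/-- The standard ball numbering `α ⟨a, r⟩ = B(ν a; nuQpos r)`. -/
def ballNum (ν : ℕ → X) (n : ℕ) : Set X := Metric.ball (ν n.unpair.1) (nuQpos n.unpair.2 : ℝ)

/-- The shift of a numbering of sets: `0 ↦ ∅`, `n + 1 ↦ α n`. -/
def shiftNum (α : ℕ → Set X) : ℕ → Set X
  | 0 => ∅
  | n + 1 => α n

/-- The representation of open sets by enumerations of basic balls. -/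
def sigmaRep (ν : ℕ → X) : Rep (Opens X) := fun p U =>
  (U : Set X) = ⋃ i, shiftNum (ballNum ν) (p i)

/-- The representation of closed sets by names of their complements. -/
def piRep (ν : ℕ → X) : Rep (Closeds X) := fun p A => sigmaRep ν p A.compl

/-- The representation `δ_range` of closed sets, by dense sequences of points. -/
def rangeRep (ν : ℕ → X) : Rep (Closeds X) := fun s A =>
  ((A : Set X) = ∅ ∧ ∀ i k, projω s i k = 0) ∨
  ((A : Set X).Nonempty ∧
    (∀ i, ∃ y ∈ A, (cauchyRep ν).shift (projω s i) y) ∧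
    ∀ x ∈ A, ∀ U : Set X, IsOpen U → x ∈ U → ∃ i, ∃ y ∈ U, (cauchyRep ν).shift (projω s i) y)

/-- The representation `δ_dist^>` of closed sets, by `η`-names of realizers of the distance
function `d_A`, as a function with values in the extended reals under `rhoLower`
(`d_∅ = ∞`). -/
def distRep (ν : ℕ → X) : Rep (Closeds X) := fun p A =>
  Realizes (cauchyRep ν) rhoLower (eta p) fun x => ((Metric.infEDist x (A : Set X) : ENNReal) : EReal)

/-! Locally finite sequences and Dugundji systems -/

/-- The sequence `V` is locally finite in its union: each point of each member has a basic
neighbourhood meeting only finitely many members. -/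
def LF (α : ℕ → Set X) (V : ℕ → Opens X) : Prop :=
  ∀ x, ∀ i, x ∈ V i → ∃ a, ∃ S : Finset ℕ, x ∈ α a ∧ {j | ((V j : Set X) ∩ α a).Nonempty} ⊆ S

/-- The representation `δ₁` of locally finite sequences of open sets: a name is `⟨p, q, r⟩`, where
`p` names the sequence, the sets `α (q i)` cover its union, and the members meeting `α (q i)` have
their indices in the finite set with canonical (binary) code `r i`. -/
def delta1 (ν : ℕ → X) (α : ℕ → Set X) : Rep (ℕ → Opens X) := fun s V =>
  LF α V ∧ (sigmaRep ν).seq (proj3 s 0) V ∧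
    (⋃ j, (V j : Set X)) ⊆ ⋃ i, α (proj3 s 1 i) ∧
    ∀ i, {j | ((V j : Set X) ∩ α (proj3 s 1 i)).Nonempty} ⊆ {j | (proj3 s 2 i).testBit j = true}

/-- The representation `δ₂`: the cover in the name is moreover exact. -/
def delta2 (ν : ℕ → X) (α : ℕ → Set X) : Rep (ℕ → Opens X) := fun s V =>
  delta1 ν α s V ∧ (⋃ j, (V j : Set X)) = ⋃ i, α (proj3 s 1 i)

/-- The distance between two sets, `∞` if one of them is empty. -/
noncomputable def setDist (S T : Set X) : ENNReal := ⨅ x ∈ S, ⨅ y ∈ T, edist x y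

/-- `(V, y)` is a Dugundji system for the nonempty closed set `A`, with coefficient `1 + ε`. -/
def IsDugundjiSystem (ν : ℕ → X) (ε : ℝ) (A : Closeds X) (V : ℕ → Opens X) (y : ℕ → X) : Prop :=
  (A : Set X).Nonempty ∧ LF (shiftNum (ballNum ν)) V ∧
    (⋃ i, (V i : Set X)) = (A : Set X)ᶜ ∧ (∀ i, y i ∈ A) ∧
    (∀ i, ∀ x ∈ V i, dist x (y i) ≤ (1 + ε) * Metric.infDist x (A : Set X)) ∧
    ∀ n : ℕ → ℕ, Tendsto (fun i => setDist (V (n i) : Set X) (A : Set X)) atTop (𝓝 0) →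
      Tendsto (fun i => Metric.ediam (V (n i) : Set X)) atTop (𝓝 0)

/-- The closed set `π((V, y)) = X \ ⋃ i, V i`. -/
def piSet (D : (ℕ → Opens X) × (ℕ → X)) : Closeds X := (⨆ i, D.1 i).compl

/-- The set `𝒟(X)` of Dugundji systems with coefficient `2`. -/
def systems (ν : ℕ → X) : Set ((ℕ → Opens X) × (ℕ → X)) :=
  {D | IsDugundjiSystem ν 1 (piSet D) D.1 D.2}

/-- The representation `δ₃` of Dugundji systems. -/
def delta3 (ν : ℕ → X) : Rep ((ℕ → Opens X) × (ℕ → X)) := fun s D =>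
  D ∈ systems ν ∧ delta2 ν (shiftNum (ballNum ν)) (proj2 s 0) D.1 ∧
    (cauchyRep ν).seq (proj2 s 1) D.2

/-- The representation `δ₄` of nonempty closed sets by names of Dugundji systems. -/
def delta4 (ν : ℕ → X) : Rep (Closeds X) := fun s A =>
  ∃ D ∈ systems ν, piSet D = A ∧ delta3 ν s D

/-- The representation `δ₈` of nonempty closed sets: a name of `A` is `⟨p, q⟩`, where `p` is a
`δ_range`-name of a closed set between the boundary of `A` and `A`, and `q` names `A` as a
closed set. -/
def delta8 (ν : ℕ → X) : Rep (Closeds X) := fun s A =>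
  (A : Set X).Nonempty ∧
    (∃ B : Closeds X, frontier (A : Set X) ⊆ B ∧ (B : Set X) ⊆ A ∧ rangeRep ν (proj2 s 0) B) ∧
    piRep ν (proj2 s 1) A

/-- The closed sets other than `∅` and `X`. -/
def properClosed (X : Type*) [MetricSpace X] : Set (Closeds X) :=
  {A | (A : Set X) ≠ ∅ ∧ (A : Set X) ≠ Set.univ}

end Metric

end Dugundji

/-! From `δ₄` to `δ₈`: a boundary point x of A is a limit of points z outside A. Such a z lies in
some V_i, and d(z, y_i) ≤ 2 d(z, A) ≤ 2 d(z, x), so y_i is close to x as well. Hence the closure of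
{y_i} lies between ∂A and A, and the exact ball cover in the `δ₄`-name is already a `δ_{Π⁰₁}`-name
of A. The transformation only rearranges entries.

From `δ_range ⊓ δ_dist^>` to `δ₄`: lower bounds on d(·, A) allow an enumeration of all basic balls
B(c_n; r_n) with 4 r_n < d(c_n, A), and these cover X \ A. To make the cover locally finite, remove
from the n-th ball the points lying at depth at least 2⁻ⁿ in an earlier ball (`refinement`). A point
keeps its place in the first ball containing it, so the union is unchanged. A small ball well inside
B(c_l; r_l) meets only finitely many members, with a bound that can be found by search
(`lt_of_refinement_meets_ball`). Choose y_n in the given dense sequence with d(c_n, y_n) < d(c_n, A)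
+ r_n. Every x in the n-th member has d(x, A) ≥ 3 r_n, which gives both d(x, y_n) ≤ 2 d(x, A) and
the diameter condition (`isDugundjiSystem_refinement`).

Effectivity rests on one notion, `Semi`: a relation accepted by a primitive recursive test on some
finite prefix of the name. All choices above satisfy strict inequalities of this kind, so they can
be made by search (`Semi.uniformize`, `Semi.enumerate`). A function with semidecidable graph
(`CompFrom`) is finally turned into a monotone word function by `CompFrom.isComputable`. -/

namespace Dugundji

/-! Primitive recursive functions: rules for `fun_prop` -/

section PrimrecRules

variable {α β γ : Type*} [Primcodable α] [Primcodable β] [Primcodable γ]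

attribute [fun_prop] Primrec
attribute [fun_prop] Primrec.id Primrec.const Primrec.comp Primrec.pair Primrec.unpair
  Primrec.list_length Primrec.list_range

@[fun_prop]
theorem primrec_fst {f : α → β × γ} (hf : Primrec f) : Primrec fun a => (f a).1 :=
  Primrec.fst.comp hf

@[fun_prop]
theorem primrec_snd {f : α → β × γ} (hf : Primrec f) : Primrec fun a => (f a).2 :=
  Primrec.snd.comp hf

@[fun_prop]
theorem primrec_add {f g : α → ℕ} (hf : Primrec f) (hg : Primrec g) :
    Primrec fun a => f a + g a :=
  Primrec.nat_add.comp hf hg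

@[fun_prop]
theorem primrec_sub {f g : α → ℕ} (hf : Primrec f) (hg : Primrec g) :
    Primrec fun a => f a - g a :=
  Primrec.nat_sub.comp hf hg

@[fun_prop]
theorem primrec_mul {f g : α → ℕ} (hf : Primrec f) (hg : Primrec g) :
    Primrec fun a => f a * g a :=
  Primrec.nat_mul.comp hf hg

@[fun_prop]
theorem primrec_div {f g : α → ℕ} (hf : Primrec f) (hg : Primrec g) :
    Primrec fun a => f a / g a :=
  Primrec.nat_div.comp hf hg

@[fun_prop]
theorem primrec_mod {f g : α → ℕ} (hf : Primrec f) (hg : Primrec g) :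
    Primrec fun a => f a % g a :=
  Primrec.nat_mod.comp hf hg

@[fun_prop]
theorem primrec_pow {f g : α → ℕ} (hf : Primrec f) (hg : Primrec g) :
    Primrec fun a => f a ^ g a :=
  (Primrec₂.unpaired'.1 Nat.Primrec.pow).comp hf hg

@[fun_prop]
theorem primrec_natPair {f g : α → ℕ} (hf : Primrec f) (hg : Primrec g) :
    Primrec fun a => Nat.pair (f a) (g a) :=
  Primrec₂.natPair.comp hf hg

@[fun_prop]
theorem primrec_encode {f : α → β} (hf : Primrec f) :
    Primrec fun a => Encodable.encode (f a) :=
  Primrec.encode.comp hf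

@[fun_prop]
theorem primrec_decode {f : α → ℕ} (hf : Primrec f) :
    Primrec fun a => (Encodable.decode (f a) : Option β) :=
  Primrec.decode.comp hf

@[fun_prop]
theorem primrec_some {f : α → β} (hf : Primrec f) : Primrec fun a => some (f a) :=
  Primrec.option_some.comp hf

@[fun_prop]
theorem primrec_option_getD {f : α → Option β} {g : α → β} (hf : Primrec f) (hg : Primrec g) :
    Primrec fun a => (f a).getD (g a) :=
  Primrec.option_getD.comp hf hg

theorem primrec_option_elim {f : α → Option β} {g : α → γ} {h : α → β → γ} (hf : Primrec f)
    (hg : Primrec g) (hh : Primrec fun x : α × β => h x.1 x.2) :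
    Primrec fun a => (f a).elim (g a) (h a) :=
  (Primrec.option_casesOn hf hg hh.to₂).of_eq fun a => by cases f a <;> rfl

@[fun_prop]
theorem primrec_take {f : α → ℕ} {g : α → List β} (hf : Primrec f) (hg : Primrec g) :
    Primrec fun a => (g a).take (f a) :=
  Primrec.list_take.comp hf hg

@[fun_prop]
theorem primrec_concat {f : α → List β} {g : α → β} (hf : Primrec f) (hg : Primrec g) :
    Primrec fun a => f a ++ [g a] :=
  Primrec.list_concat.comp hf hg

@[fun_prop]
theorem primrec_getElem? {f : α → List β} {g : α → ℕ} (hf : Primrec f) (hg : Primrec g) :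
    Primrec fun a => (f a)[g a]? :=
  Primrec.list_getElem?.comp hf hg

@[fun_prop]
theorem primrec_replicate {f : α → ℕ} {g : α → β} (hf : Primrec f) (hg : Primrec g) :
    Primrec fun a => List.replicate (f a) (g a) :=
  (Primrec.list_map (Primrec.list_range.comp hf) (hg.comp Primrec.fst).to₂).of_eq fun a => by simp

@[fun_prop]
theorem primrec_decide_eq [DecidableEq β] {f g : α → β} (hf : Primrec f) (hg : Primrec g) :
    Primrec fun a => decide (f a = g a) :=
  (Primrec.eq.comp hf hg).decide

@[fun_prop]
theorem primrec_decide_lt {f g : α → ℕ} (hf : Primrec f) (hg : Primrec g) :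
    Primrec fun a => decide (f a < g a) :=
  (Primrec.nat_lt.comp hf hg).decide

@[fun_prop]
theorem primrec_and {f g : α → Bool} (hf : Primrec f) (hg : Primrec g) :
    Primrec fun a => f a && g a :=
  Primrec.and.comp hf hg

@[fun_prop]
theorem primrec_or {f g : α → Bool} (hf : Primrec f) (hg : Primrec g) :
    Primrec fun a => f a || g a :=
  Primrec.or.comp hf hg

@[fun_prop]
theorem primrec_not {f : α → Bool} (hf : Primrec f) : Primrec fun a => !f a :=
  Primrec.not.comp hf

@[fun_prop]
theorem primrec_cond {c : α → Bool} {f g : α → β} (hc : Primrec c) (hf : Primrec f)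
    (hg : Primrec g) : Primrec fun a => bif c a then f a else g a :=
  Primrec.cond hc hf hg

theorem primrec_range_all {f : α → ℕ} {g : α → ℕ → Bool} (hf : Primrec f)
    (hg : Primrec fun x : α × ℕ => g x.1 x.2) :
    Primrec fun a => (List.range (f a)).all (g a) :=
  (Primrec.list_foldr (Primrec.list_range.comp hf) (Primrec.const true)
    (show Primrec₂ fun (a : α) (y : ℕ × Bool) => g a y.1 && y.2 from
      Primrec.and.comp (hg.comp (by fun_prop : Primrec fun x : α × (ℕ × Bool) => (x.1, x.2.1)))
        (by fun_prop))).of_eq fun a => by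
    induction List.range (f a) with
    | nil => rfl
    | cons b l ih => simp [ih]

end PrimrecRules

/-! Words -/

theorem word_length (p : Baire) (k : ℕ) : (word p k).length = k := by simp [word]

theorem word_take (p : Baire) (k j : ℕ) : (word p k).take j = word p (min j k) := by
  simp [word, List.take_range, ← List.map_take]

theorem word_take_of_le (p : Baire) {k j : ℕ} (h : j ≤ k) : (word p k).take j = word p j := by
  rw [word_take, min_eq_left h]

theorem word_getElem? (p : Baire) (k i m : ℕ) : (word p k)[i]? = some m ↔ i < k ∧ p i = m := by
  simp [word, List.getElem?_eq_some_iff]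

theorem word_succ (p : Baire) (n : ℕ) : word p (n + 1) = word p n ++ [p n] := by
  simp [word, List.range_succ]

/-! Semidecidable relations on names and numbers -/

section Semi

variable {P : Type*} {α β γ : Type*} [Primcodable α] [Primcodable β] [Primcodable γ]
  {nm : P → Baire}

/-- The relation `R π a` is semidecidable in the name `nm π`, uniformly in `π` and `a`. -/
def Semi (nm : P → Baire) (R : P → α → Prop) : Prop :=
  ∃ c : List ℕ × α → Bool, Primrec c ∧ ∀ π a, R π a ↔ ∃ k, c (word (nm π) k, a) = true

theorem Semi.of_iff {R S : P → α → Prop} (h : Semi nm R) (H : ∀ π a, S π a ↔ R π a) :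
    Semi nm S := by
  obtain ⟨c, hc, h⟩ := h
  exact ⟨c, hc, fun π a => (H π a).trans (h π a)⟩

theorem Semi.of_word {c : List ℕ × α → Bool} (hc : Primrec c) :
    Semi nm fun π a => ∃ k, c (word (nm π) k, a) = true :=
  ⟨c, hc, fun _ _ => Iff.rfl⟩

theorem Semi.of_primrec {c : α → Bool} (hc : Primrec c) : Semi nm fun _ a => c a = true :=
  (Semi.of_word (c := fun x : List ℕ × α => c x.2) (hc.comp Primrec.snd)).of_iff fun _ _ => by simp

theorem Semi.comp {R : P → α → Prop} (h : Semi nm R) {f : β → α} (hf : Primrec f) :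
    Semi nm fun π b => R π (f b) := by
  obtain ⟨c, hc, h⟩ := h
  exact ⟨fun x => c (x.1, f x.2), hc.comp (Primrec.fst.pair (hf.comp Primrec.snd)),
    fun π b => h π (f b)⟩

/-- A semidecision procedure may guess a bound on the part of the name it reads and a witness. -/
theorem Semi.of_guess {c : List ℕ × β × α → Bool} (hc : Primrec c) :
    Semi nm fun π a => ∃ k b, c (word (nm π) k, b, a) = true := by
  -- The length of the prefix is itself decoded as a pair: a shorter length to which the prefix is
  -- cut, and a code of the witness.
  refine (Semi.of_word (c := fun x : List ℕ × α =>
    (Encodable.decode (α := β) x.1.length.unpair.2).elim false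
      fun b => c (x.1.take x.1.length.unpair.1, b, x.2)) ?_).of_iff fun π a => ⟨?_, ?_⟩
  · refine primrec_option_elim (by fun_prop) (by fun_prop) ?_
    exact hc.comp (by fun_prop)
  · rintro ⟨k, b, h⟩
    refine ⟨Nat.pair k (Encodable.encode b), ?_⟩
    simpa [word_length, word_take_of_le _ (Nat.left_le_pair k _)] using h
  · rintro ⟨k, h⟩
    simp only [word_length] at h
    cases hb : (Encodable.decode k.unpair.2 : Option β) with
    | none => simp [hb] at h
    | some b =>
      rw [hb, Option.elim_some, word_take_of_le _ (Nat.unpair_left_le k)] at h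
      exact ⟨_, b, h⟩

theorem Semi.exists {R : P → β → α → Prop} (h : Semi nm fun π (x : β × α) => R π x.1 x.2) :
    Semi nm fun π a => ∃ b, R π b a := by
  obtain ⟨c, hc, h⟩ := h
  refine (Semi.of_guess hc).of_iff fun π a => ?_
  rw [exists_comm]
  exact exists_congr fun b => h π (b, a)

/-- Tests need not stay true on longer prefixes, so two separate prefix lengths are guessed. -/
theorem Semi.and {R S : P → α → Prop} (hR : Semi nm R) (hS : Semi nm S) :
    Semi nm fun π a => R π a ∧ S π a := by
  obtain ⟨c, hc, hR⟩ := hR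
  obtain ⟨d, hd, hS⟩ := hS
  refine (Semi.of_guess (β := ℕ × ℕ) (c := fun x : List ℕ × (ℕ × ℕ) × α =>
    c (x.1.take x.2.1.1, x.2.2) && d (x.1.take x.2.1.2, x.2.2)) (by fun_prop)).of_iff
    fun π a => ?_
  rw [hR, hS]
  simp only [word_take, Bool.and_eq_true]
  constructor
  · rintro ⟨⟨i, hi⟩, ⟨j, hj⟩⟩
    exact ⟨max i j, (i, j), by simpa using hi, by simpa using hj⟩
  · rintro ⟨k, b, hi, hj⟩
    exact ⟨⟨_, hi⟩, ⟨_, hj⟩⟩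

theorem Semi.or {R S : P → α → Prop} (hR : Semi nm R) (hS : Semi nm S) :
    Semi nm fun π a => R π a ∨ S π a := by
  obtain ⟨c, hc, hR⟩ := hR
  obtain ⟨d, hd, hS⟩ := hS
  refine (Semi.of_word (c := fun x => c x || d x) (by fun_prop)).of_iff fun π a => ?_
  rw [hR, hS, ← exists_or]
  simp

/-- The guess is a finite list holding one prefix length for each i below the bound. -/
theorem Semi.forall_lt {R : P → ℕ → α → Prop} (h : Semi nm fun π (x : ℕ × α) => R π x.1 x.2)
    {f : α → ℕ} (hf : Primrec f) : Semi nm fun π a => ∀ i < f a, R π i a := by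
  obtain ⟨c, hc, h⟩ := h
  refine (Semi.of_guess (β := List ℕ) (c := fun x : List ℕ × List ℕ × α =>
    (List.range (f x.2.2)).all fun i => c (x.1.take (x.2.1[i]?.getD 0), (i, x.2.2))) ?_).of_iff
    fun π a => ?_
  · exact primrec_range_all (by fun_prop) (by fun_prop)
  · simp only [word_take, List.all_eq_true, List.mem_range]
    constructor
    · intro H
      have : ∀ i, ∃ k, i < f a → c (word (nm π) k, (i, a)) = true := by
        intro i
        by_cases hi : i < f a
        · obtain ⟨k, hk⟩ := (h π (i, a)).1 (H i hi)
          exact ⟨k, fun _ => hk⟩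
        · exact ⟨0, fun h => absurd h hi⟩
      choose g hg using this
      refine ⟨(Finset.range (f a)).sup g, (List.range (f a)).map g, fun i hi => ?_⟩
      have hle : g i ≤ (Finset.range (f a)).sup g := Finset.le_sup (Finset.mem_range.2 hi)
      simpa [hi, min_eq_left hle] using hg i hi
    · rintro ⟨k, l, H⟩ i hi
      exact (h π (i, a)).2 ⟨_, H i hi⟩

theorem Semi.entry : Semi nm fun π (x : ℕ × ℕ) => nm π x.1 = x.2 := by
  refine (Semi.of_word (c := fun x : List ℕ × ℕ × ℕ => decide (x.1[x.2.1]? = some x.2.2))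
    (by fun_prop)).of_iff fun π x => ?_
  simp only [decide_eq_true_eq, word_getElem?]
  exact ⟨fun h => ⟨x.1 + 1, by simp, h⟩, fun ⟨k, _, h⟩ => h⟩

theorem Semi.word : Semi nm fun π (w : List ℕ) => w = word (nm π) w.length := by
  classical
  refine (Semi.of_word (c := fun x : List ℕ × List ℕ => decide (x.1 = x.2))
    (by fun_prop)).of_iff fun π x => ?_
  simp only [decide_eq_true_eq]
  exact ⟨fun h => ⟨x.length, h.symm⟩, by rintro ⟨k, rfl⟩; rw [word_length]⟩

/-- The length of the prefix serves as the step bound for running a program of `f`; the content of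
the name is ignored. -/
theorem Semi.of_computable {f : α → β} (hf : Computable f) :
    Semi nm fun _ (x : α × β) => f x.1 = x.2 := by
  obtain ⟨e, he⟩ := Nat.Partrec.Code.exists_code.1 hf
  have key : ∀ a b, f a = b ↔ ∃ k, Nat.Partrec.Code.evaln k e (Encodable.encode a) =
      some (Encodable.encode b) := by
    intro a b
    have := Nat.Partrec.Code.evaln_complete (c := e) (n := Encodable.encode a)
      (x := Encodable.encode b)
    simp only [Option.mem_def] at this
    rw [← this, he]
    simp [eq_comm]
  refine (Semi.of_word (c := fun x : List ℕ × α × β =>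
    decide (Nat.Partrec.Code.evaln x.1.length e (Encodable.encode x.2.1) =
      some (Encodable.encode x.2.2))) ?_).of_iff fun π x => ?_
  · refine primrec_decide_eq ?_ (by fun_prop)
    exact Nat.Partrec.Code.primrec_evaln.comp
      (f := fun a : (ℕ × Nat.Partrec.Code) × ℕ => Nat.Partrec.Code.evaln a.1.1 a.1.2 a.2)
      (g := fun x : List ℕ × α × β => ((x.1.length, e), Encodable.encode x.2.1)) (by fun_prop)
  · simp only [word_length, decide_eq_true_eq]
    exact key _ _

/-! Functions computable from a name -/

/-- The function `a ↦ G π a` is computable from the name `nm π`, uniformly in `π`. -/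
def CompFrom (nm : P → Baire) (G : P → α → β) : Prop :=
  Semi nm fun π (x : α × β) => G π x.1 = x.2

theorem CompFrom.of_primrec {f : α → β} (hf : Primrec f) : CompFrom nm fun _ => f :=
  Semi.of_computable hf.to_comp

theorem CompFrom.entry : CompFrom nm fun π n => nm π n := Semi.entry

theorem CompFrom.of_eq {F G : P → α → β} (h : CompFrom nm F) (H : ∀ π a, F π a = G π a) :
    CompFrom nm G :=
  Semi.of_iff h fun π x => by rw [H]

theorem Semi.subst {R : P → α → Prop} (h : Semi nm R) {G : P → β → α} (hG : CompFrom nm G) :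
    Semi nm fun π b => R π (G π b) := by
  refine (Semi.exists (R := fun π a b => G π b = a ∧ R π a)
    (Semi.and (Semi.comp hG (f := fun x : α × β => (x.2, x.1)) (by fun_prop))
      (h.comp (by fun_prop)))).of_iff fun π b => by simp

theorem CompFrom.comp {F : P → β → γ} {G : P → α → β} (hF : CompFrom nm F)
    (hG : CompFrom nm G) : CompFrom nm fun π a => F π (G π a) := by
  have h : CompFrom nm fun π (x : α × γ) => (G π x.1, x.2) := by
    refine (Semi.and (Semi.comp hG (f := fun x : (α × γ) × β × γ => (x.1.1, x.2.1))
      (by fun_prop)) (Semi.of_primrec (c := fun x : (α × γ) × β × γ =>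
        @decide (x.1.2 = x.2.2) (Encodable.decidableEqOfEncodable γ _ _)) ?_)).of_iff
      fun π x => ?_
    · let _ := Encodable.decidableEqOfEncodable γ
      exact primrec_decide_eq (by fun_prop) (by fun_prop)
    · simp [Prod.ext_iff]
  exact Semi.subst (R := fun π (x : β × γ) => F π x.1 = x.2) hF h

theorem CompFrom.pair {F : P → α → β} {G : P → α → γ} (hF : CompFrom nm F)
    (hG : CompFrom nm G) : CompFrom nm fun π a => (F π a, G π a) :=
  (Semi.and (Semi.comp hF (f := fun x : α × β × γ => (x.1, x.2.1)) (by fun_prop))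
    (Semi.comp hG (f := fun x : α × β × γ => (x.1, x.2.2)) (by fun_prop))).of_iff
    fun π x => by simp [Prod.ext_iff]

theorem CompFrom.cond {c : α → Bool} (hc : Primrec c) {F G : P → α → β} (hF : CompFrom nm F)
    (hG : CompFrom nm G) : CompFrom nm fun π a => bif c a then F π a else G π a := by
  refine (Semi.or
    (Semi.and (Semi.of_primrec (c := fun x : α × β => c x.1) (hc.comp Primrec.fst)) hF)
    (Semi.and (Semi.of_primrec (c := fun x : α × β => !c x.1) (by fun_prop)) hG)).of_iff
    fun π x => ?_
  cases h : c x.1 <;> simp [h]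

/-- Every total semidecidable relation contains the graph of a computable function. -/
theorem Semi.uniformize {R : P → α → β → Prop} (h : Semi nm fun π (x : α × β) => R π x.1 x.2)
    (H : ∀ π a, ∃ b, R π a b) :
    ∃ G : P → α → β, CompFrom nm G ∧ ∀ π a, R π a (G π a) := by
  obtain ⟨c, hc, h⟩ := h
  -- At stage k the number k is decoded as a prefix length and a candidate; the candidate is
  -- returned if the test accepts it. The function selected takes the answer of the first successful
  -- stage.
  let d : List ℕ × α → Option β := fun x =>
    (Encodable.decode (α := β) x.1.length.unpair.2).elim none
      fun b => bif c (x.1.take x.1.length.unpair.1, (x.2, b)) then some b else none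
  have hd : Primrec d := by
    refine primrec_option_elim (by fun_prop) (by fun_prop) ?_
    exact primrec_cond (hc.comp (by fun_prop)) (by fun_prop) (by fun_prop)
  have hd_some : ∀ π a k b, d (Dugundji.word (nm π) k, a) = some b → R π a b := by
    intro π a k b hb
    simp only [d, word_length] at hb
    cases hb' : (Encodable.decode k.unpair.2 : Option β) with
    | none => simp [hb'] at hb
    | some b' =>
      rw [hb', Option.elim_some] at hb
      cases hcb : c ((Dugundji.word (nm π) k).take k.unpair.1, (a, b')) with
      | false => simp [hcb] at hb
      | true =>
        rw [hcb, cond_true, Option.some_inj] at hb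
        subst hb
        rw [word_take] at hcb
        exact (h π (a, b')).2 ⟨_, hcb⟩
  have hd_ex : ∀ π a, ∃ k, (d (Dugundji.word (nm π) k, a)).isSome = true := by
    intro π a
    obtain ⟨b, hb⟩ := H π a
    obtain ⟨k, hk⟩ := (h π (a, b)).1 hb
    refine ⟨Nat.pair k (Encodable.encode b), ?_⟩
    simp [d, word_length, word_take_of_le _ (Nat.left_le_pair k _), hk]
  refine ⟨fun π a => (d (Dugundji.word (nm π) (Nat.find (hd_ex π a)), a)).get
    (Nat.find_spec (hd_ex π a)), ?_, fun π a => hd_some π a _ _ (Option.some_get _).symm⟩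
  let _ := Encodable.decidableEqOfEncodable β
  -- Minimality of the stage is decidable, since earlier stages only read shorter prefixes.
  refine (Semi.of_word (c := fun x : List ℕ × α × β => decide (d (x.1, x.2.1) = some x.2.2) &&
    (List.range x.1.length).all fun j => !(d (x.1.take j, x.2.1)).isSome) ?_).of_iff
    fun π x => ?_
  · refine primrec_and (by fun_prop) (primrec_range_all (by fun_prop) (primrec_not ?_))
    exact Primrec.option_isSome.comp (hd.comp (by fun_prop))
  · simp only [Bool.and_eq_true, decide_eq_true_eq, List.all_eq_true, List.mem_range,
      Bool.not_eq_true', word_length]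
    constructor
    · intro hx
      refine ⟨Nat.find (hd_ex π x.1), ?_, fun j hj => ?_⟩
      · rw [← hx, Option.some_get]
      · rw [word_take_of_le _ hj.le]
        simpa using Nat.find_min (hd_ex π x.1) hj
    · rintro ⟨k, hk, hlt⟩
      have : Nat.find (hd_ex π x.1) = k := by
        rw [Nat.find_eq_iff]
        refine ⟨by simp [hk], fun j hj => ?_⟩
        have := hlt j hj
        rw [word_take_of_le _ hj.le] at this
        simp [this]
      simp [this, hk]

/-- Nonempty semidecidable sets can be enumerated. -/
theorem Semi.enumerate {E : P → α → β → Prop} (h : Semi nm fun π (x : α × β) => E π x.1 x.2)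
    (H : ∀ π a, ∃ b, E π a b) :
    ∃ e : P → α × ℕ → β, CompFrom nm e ∧ ∀ π a b, E π a b ↔ ∃ i, e π (a, i) = b := by
  obtain ⟨c, hc, hE⟩ := h
  have hE' : Semi nm fun π (x : α × β) => E π x.1 x.2 := ⟨c, hc, hE⟩
  let _ := Encodable.decidableEqOfEncodable β
  let t : List ℕ × α → ℕ → Bool := fun y n =>
    (Encodable.decode (α := β) n).elim false fun b => c (y.1, (y.2, b))
  have ht : Primrec fun x : (List ℕ × α) × ℕ => t x.1 x.2 := by
    refine primrec_option_elim (by fun_prop) (by fun_prop) ?_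
    exact hc.comp (by fun_prop)
  -- Index ⟨k, n⟩ must yield the element coded by n if the test accepts it on the prefix of length
  -- k. Otherwise any element of the set will do, and one exists by nonemptiness.
  have hT : Semi nm fun π (x : (α × ℕ) × β) =>
      ∃ w : List ℕ, (w = Dugundji.word (nm π) w.length ∧ w.length = x.1.2.unpair.1) ∧
        (((t (w, x.1.1) x.1.2.unpair.2 = true) ∧
          Encodable.decode x.1.2.unpair.2 = some x.2) ∨
          (t (w, x.1.1) x.1.2.unpair.2 = false ∧ E π x.1.1 x.2)) := by
    refine Semi.exists (R := fun π (w : List ℕ) (x : (α × ℕ) × β) =>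
      (w = Dugundji.word (nm π) w.length ∧ w.length = x.1.2.unpair.1) ∧
        (((t (w, x.1.1) x.1.2.unpair.2 = true) ∧
          Encodable.decode x.1.2.unpair.2 = some x.2) ∨
          (t (w, x.1.1) x.1.2.unpair.2 = false ∧ E π x.1.1 x.2))) ?_
    have h1 : Primrec fun y : List ℕ × (α × ℕ) × β => t (y.1, y.2.1.1) y.2.1.2.unpair.2 :=
      ht.comp (by fun_prop : Primrec fun y : List ℕ × (α × ℕ) × β =>
        ((y.1, y.2.1.1), y.2.1.2.unpair.2))
    refine ((Semi.word.comp (f := fun y : List ℕ × (α × ℕ) × β => y.1) (by fun_prop)).and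
      ((Semi.of_primrec (c := fun y : List ℕ × (α × ℕ) × β =>
        decide (y.1.length = y.2.1.2.unpair.1)) (by fun_prop)).of_iff fun π x => by simp)).and
      ((((Semi.of_primrec h1).and ((Semi.of_primrec (c := fun y : List ℕ × (α × ℕ) × β =>
        decide (Encodable.decode (α := β) y.2.1.2.unpair.2 = some y.2.2)) (by fun_prop)).of_iff
        fun π x => by simp))).or
        (((Semi.of_primrec (primrec_not h1)).of_iff fun π x => by simp).and
          (hE'.comp (f := fun y : List ℕ × (α × ℕ) × β => (y.2.1.1, y.2.2)) (by fun_prop))))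
  obtain ⟨e, he, heT⟩ := Semi.uniformize (R := fun π (y : α × ℕ) (b : β) =>
      ∃ w : List ℕ, (w = Dugundji.word (nm π) w.length ∧ w.length = y.2.unpair.1) ∧
        (((t (w, y.1) y.2.unpair.2 = true) ∧ Encodable.decode y.2.unpair.2 = some b) ∨
          (t (w, y.1) y.2.unpair.2 = false ∧ E π y.1 b))) hT (by
    intro π y
    refine (exists_comm.1 ⟨Dugundji.word (nm π) y.2.unpair.1, ?_⟩)
    by_cases hb : t (Dugundji.word (nm π) y.2.unpair.1, y.1) y.2.unpair.2 = true
    · have hb' := hb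
      simp only [t] at hb'
      cases hd : (Encodable.decode y.2.unpair.2 : Option β) with
      | none => simp [hd] at hb'
      | some b => exact ⟨b, by simp [word_length], Or.inl ⟨hb, rfl⟩⟩
    · obtain ⟨b, hEb⟩ := H π y.1
      exact ⟨b, by simp [word_length], Or.inr ⟨by simpa using hb, hEb⟩⟩)
  refine ⟨e, he, fun π a b => ⟨fun hb => ?_, ?_⟩⟩
  · obtain ⟨k, hk⟩ := (hE π (a, b)).1 hb
    refine ⟨Nat.pair k (Encodable.encode b), ?_⟩
    obtain ⟨w, ⟨hw, hwl⟩, hor⟩ := heT π (a, Nat.pair k (Encodable.encode b))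
    simp only [Nat.unpair_pair] at hwl hor
    rw [hwl] at hw
    subst hw
    rcases hor with ⟨_, h2⟩ | ⟨h1, _⟩
    · simpa using h2.symm
    · simp [t, hk] at h1
  · rintro ⟨i, rfl⟩
    obtain ⟨w, ⟨hw, -⟩, ⟨h1, h2⟩ | ⟨-, h2⟩⟩ := heT π (a, i)
    · simp only at h1 h2
      simp only [t, h2, Option.elim_some] at h1
      refine (hE π (a, e π (a, i))).2 ⟨w.length, ?_⟩
      rwa [← hw]
    · exact h2

end Semi

/-! Computable operators on Baire space -/

section Operators

/-- The first `t` steps of the search for output on input `w`: in step `i`, the number `i` is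
tried as a witness for the next entry of the output. -/
def searchOutput (c : List ℕ × ℕ × ℕ → Bool) (w : List ℕ) : ℕ → List ℕ
  | 0 => []
  | t + 1 => bif c (w.take t.unpair.1, (searchOutput c w t).length, t.unpair.2.unpair.1) then
      searchOutput c w t ++ [t.unpair.2.unpair.1] else searchOutput c w t

variable {c : List ℕ × ℕ × ℕ → Bool}

theorem primrec_searchOutput (hc : Primrec c) :
    Primrec fun w => searchOutput c w w.length := by
  refine (Primrec.nat_rec' (f := List.length) (g := fun _ => []) (h := fun (w : List ℕ)
    (x : ℕ × List ℕ) => bif c (w.take x.1.unpair.1, x.2.length, x.1.unpair.2.unpair.1) then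
      x.2 ++ [x.1.unpair.2.unpair.1] else x.2) (by fun_prop) (by fun_prop) ?_).of_eq fun w => ?_
  · refine primrec_cond (hc.comp ?_) ?_ ?_ <;> fun_prop
  · induction w.length with
    | zero => rfl
    | succ t ih => rw [searchOutput, ← ih]

theorem searchOutput_prefix_succ (w : List ℕ) (t : ℕ) :
    searchOutput c w t <+: searchOutput c w (t + 1) := by
  rw [searchOutput]
  cases c (w.take t.unpair.1, (searchOutput c w t).length, t.unpair.2.unpair.1)
  · exact List.prefix_rfl
  · exact List.prefix_append _ _

theorem searchOutput_prefix (w : List ℕ) {s t : ℕ} (h : s ≤ t) :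
    searchOutput c w s <+: searchOutput c w t := by
  induction t, h using Nat.le_induction with
  | base => exact List.prefix_rfl
  | succ t _ ih => exact ih.trans (searchOutput_prefix_succ w t)

/-- Step s reads a prefix of length at most s, because `s.unpair.1 ≤ s`. Thus a longer input repeats
the earlier steps unchanged, which is the source of monotonicity. -/
theorem searchOutput_congr {u v : List ℕ} {t : ℕ} (h : ∀ s < t, u.take s = v.take s) :
    searchOutput c u t = searchOutput c v t := by
  induction t with
  | zero => rfl
  | succ t ih =>
    rw [searchOutput, searchOutput, ih fun s hs => h s (by omega),
      h t.unpair.1 (Nat.lt_succ_of_le (Nat.unpair_left_le t))]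

theorem searchOutput_mono {u v : List ℕ} (h : u <+: v) :
    searchOutput c u u.length <+: searchOutput c v v.length := by
  rw [searchOutput_congr (v := v) fun s hs => ?_]
  · exact searchOutput_prefix v h.length_le
  · obtain ⟨t, rfl⟩ := h
    rw [List.take_append_of_le_length hs.le]

/-- Every function computable from names is given by a computable operator. -/
theorem CompFrom.isComputable {P : Type*} {nm : P → Baire} {G : P → ℕ → ℕ}
    (hG : CompFrom nm G) : ∃ F : Baire →. Baire, IsComputable F ∧ ∀ π, G π ∈ F (nm π) := by
  obtain ⟨c, hc, h⟩ := hG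
  let H : List ℕ → List ℕ := fun w => searchOutput c w w.length
  have hmono : ∀ u v, u <+: v → H u <+: H v := fun u v => searchOutput_mono
  have huniq : ∀ p q q' : Baire, (∀ n, ∃ k, word q n <+: H (word p k)) →
      (∀ n, ∃ k, word q' n <+: H (word p k)) → q = q' := by
    intro p q q' hq hq'
    funext n
    obtain ⟨k, hk⟩ := hq (n + 1)
    obtain ⟨k', hk'⟩ := hq' (n + 1)
    have hle : ∀ i j, i ≤ j → H (word p i) <+: H (word p j) := fun i j hij =>
      hmono _ _ (by rw [← word_take_of_le p hij]; exact List.take_prefix _ _)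
    have h1 := hk.trans (hle _ _ (le_max_left k k'))
    have h2 := hk'.trans (hle _ _ (le_max_right k k'))
    have h3 := (List.prefix_of_prefix_length_le h1 h2 (by simp [word_length])).eq_of_length
      (by simp [word_length])
    have h4 := congrArg (fun l : List ℕ => l[n]?) h3
    simpa [word] using h4
  classical
  let F : Baire →. Baire := fun p =>
    ⟨∃ q, ∀ n, ∃ k, word q n <+: H (word p k), fun hp => hp.choose⟩
  have hF : ∀ p q, q ∈ F p ↔ ∀ n, ∃ k, word q n <+: H (word p k) := by
    intro p q
    constructor
    · rintro ⟨hp, rfl⟩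
      exact hp.choose_spec
    · intro hq
      have hp : ∃ q, ∀ n, ∃ k, word q n <+: H (word p k) := ⟨q, hq⟩
      exact ⟨hp, huniq p _ _ hp.choose_spec hq⟩
  refine ⟨F, ⟨H, (primrec_searchOutput hc).to_comp, hmono, hF⟩, fun π => (hF _ _).2 ?_⟩
  -- Only correct entries are ever written, because acceptance by the test certifies a point of the
  -- graph of `G π`.
  have hsound : ∀ k t, ∃ n, searchOutput c (word (nm π) k) t = word (G π) n := by
    intro k t
    induction t with
    | zero => exact ⟨0, rfl⟩
    | succ t ih =>
      obtain ⟨n, hn⟩ := ih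
      rw [searchOutput, hn, word_take, word_length]
      cases hb : c (word (nm π) (min t.unpair.1 k), n, t.unpair.2.unpair.1) with
      | false => exact ⟨n, rfl⟩
      | true => exact ⟨n + 1, by rw [cond_true, word_succ, (h π (n, _)).2 ⟨_, hb⟩]⟩
  intro n
  induction n with
  | zero => exact ⟨0, by simp [word]⟩
  | succ n ih =>
    obtain ⟨k, hk⟩ := ih
    obtain ⟨i, hi⟩ := (h π (n, G π n)).1 rfl
    -- The last component is padding: it makes the successful attempt recur at a step no earlier
    -- than k, when the first n entries have been written.
    let t := Nat.pair i (Nat.pair (G π n) k)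
    have hit : i ≤ t := Nat.left_le_pair _ _
    have hkt : k ≤ t := (Nat.right_le_pair _ _).trans (Nat.right_le_pair _ _)
    refine ⟨t + 1, ?_⟩
    have h1 : word (G π) n <+: searchOutput c (word (nm π) (t + 1)) t := by
      refine hk.trans ?_
      have h2 : H (word (nm π) k) = searchOutput c (word (nm π) (t + 1)) k := by
        simp only [H, word_length]
        refine searchOutput_congr fun s hs => ?_
        rw [word_take, word_take, min_eq_left hs.le, min_eq_left (by omega)]
      rw [h2]
      exact searchOutput_prefix _ hkt
    obtain ⟨m, hm⟩ := hsound (t + 1) t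
    have hmn : n ≤ m := by
      have := h1.length_le
      rwa [hm, word_length, word_length] at this
    have hpre : ∀ {a b}, a ≤ b → word (G π) a <+: word (G π) b := fun hab => by
      rw [← word_take_of_le (G π) hab]; exact List.take_prefix _ _
    rcases hmn.eq_or_lt with rfl | hlt
    · have : H (word (nm π) (t + 1)) = word (G π) (n + 1) := by
        simp only [H, word_length]
        rw [searchOutput, hm, word_length, word_take_of_le _ (by simp [t]; omega)]
        simp [t, hi, word_succ]
      rw [this]
    · refine (hpre hlt).trans ?_
      rw [← hm]
      simp only [H, word_length]
      exact searchOutput_prefix_succ _ _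

/-- A reduction between representations can be given by a function computable from the names. -/
theorem Rep.Reducible.of_compFrom {Y : Type*} {δ δ' : Rep Y}
    {G : {x : Baire × Y // δ x.1 x.2} → ℕ → ℕ}
    (hG : CompFrom (fun x : {x : Baire × Y // δ x.1 x.2} => x.1.1) G)
    (h : ∀ x, δ' (G x) x.1.2) : δ.Reducible δ' := by
  obtain ⟨F, hF, hFG⟩ := hG.isComputable
  exact ⟨F, hF, fun p y hp => ⟨_, hFG ⟨(p, y), hp⟩, h ⟨(p, y), hp⟩⟩⟩

end Operators

/-! Rational numbers -/

section Rational

variable {α β : Type*} [Primcodable α] [Primcodable β]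

/-- The rational-valued function `g` is primitive recursive. -/
def RatPrimrec (g : α → ℚ) : Prop := ∃ c : α → ℕ, Primrec c ∧ ∀ a, nuQ (c a) = g a

theorem nuQ_pair (a b c : ℕ) :
    nuQ (Nat.pair (Nat.pair a b) c) = ((a : ℚ) - b) / ((c : ℚ) + 1) := by
  simp [nuQ]

theorem nuQ_surjective (x : ℚ) : ∃ n, nuQ n = x := by
  refine ⟨Nat.pair (Nat.pair x.num.toNat (-x.num).toNat) (x.den - 1), ?_⟩
  have h1 : ((x.den - 1 : ℕ) : ℚ) + 1 = x.den := by
    exact_mod_cast Nat.sub_add_cancel x.den_pos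
  have h2 : ((x.num.toNat : ℚ) - ((-x.num).toNat : ℚ)) = x.num := by
    exact_mod_cast Int.toNat_sub_toNat_neg x.num
  rw [nuQ_pair, h1, h2, Rat.num_div_den]

theorem RatPrimrec.nuQ {f : α → ℕ} (hf : Primrec f) : RatPrimrec fun a => nuQ (f a) :=
  ⟨f, hf, fun _ => rfl⟩

theorem RatPrimrec.of_nat_div {f g : α → ℕ} (hf : Primrec f) (hg : Primrec g) :
    RatPrimrec fun a => (f a : ℚ) / ((g a : ℚ) + 1) :=
  ⟨fun a => Nat.pair (Nat.pair (f a) 0) (g a), by fun_prop, fun a => by simp [nuQ_pair]⟩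

theorem RatPrimrec.nuQpos {f : α → ℕ} (hf : Primrec f) : RatPrimrec fun a => nuQpos (f a) := by
  obtain ⟨c, hc, h⟩ := RatPrimrec.of_nat_div (f := fun a => (f a).unpair.1 + 1)
    (g := fun a => (f a).unpair.2) (by fun_prop) (by fun_prop)
  exact ⟨c, hc, fun a => by rw [h]; simp [Dugundji.nuQpos]⟩

theorem RatPrimrec.two_pow_inv {f : α → ℕ} (hf : Primrec f) :
    RatPrimrec fun a => (2⁻¹ : ℚ) ^ f a := by
  obtain ⟨c, hc, h⟩ := RatPrimrec.of_nat_div (f := fun _ : α => 1)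
    (g := fun a => 2 ^ f a - 1) (by fun_prop) (by fun_prop)
  exact ⟨c, hc, fun a => by rw [h]; simp⟩

theorem RatPrimrec.comp {g : β → ℚ} (hg : RatPrimrec g) {f : α → β} (hf : Primrec f) :
    RatPrimrec fun a => g (f a) := by
  obtain ⟨c, hc, h⟩ := hg
  exact ⟨fun a => c (f a), hc.comp hf, fun a => h (f a)⟩

theorem RatPrimrec.neg {g : α → ℚ} (hg : RatPrimrec g) : RatPrimrec fun a => -g a := by
  obtain ⟨c, hc, h⟩ := hg
  refine ⟨fun a => Nat.pair (Nat.pair (c a).unpair.1.unpair.2 (c a).unpair.1.unpair.1)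
    (c a).unpair.2, by fun_prop, fun a => ?_⟩
  beta_reduce
  rw [nuQ_pair, ← h, Dugundji.nuQ]
  ring

theorem RatPrimrec.add {f g : α → ℚ} (hf : RatPrimrec f) (hg : RatPrimrec g) :
    RatPrimrec fun a => f a + g a := by
  obtain ⟨c, hc, hf⟩ := hf
  obtain ⟨d, hd, hg⟩ := hg
  -- Denominators are stored minus one, so the new one is (c + 1)(d + 1) - 1 = cd + c + d.
  refine ⟨fun a => Nat.pair (Nat.pair
    ((c a).unpair.1.unpair.1 * ((d a).unpair.2 + 1) + (d a).unpair.1.unpair.1 * ((c a).unpair.2 + 1))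
    ((c a).unpair.1.unpair.2 * ((d a).unpair.2 + 1) + (d a).unpair.1.unpair.2 * ((c a).unpair.2 + 1)))
    ((c a).unpair.2 * (d a).unpair.2 + (c a).unpair.2 + (d a).unpair.2), by fun_prop, fun a => ?_⟩
  beta_reduce
  rw [nuQ_pair, ← hf, ← hg, Dugundji.nuQ, Dugundji.nuQ]
  push_cast
  have h1 : ((c a).unpair.2 : ℚ) + 1 ≠ 0 := by positivity
  have h2 : ((d a).unpair.2 : ℚ) + 1 ≠ 0 := by positivity
  have h3 : ((c a).unpair.2 : ℚ) * (d a).unpair.2 + (c a).unpair.2 + (d a).unpair.2 + 1 =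
    (((c a).unpair.2 : ℚ) + 1) * ((d a).unpair.2 + 1) := by ring
  rw [h3]
  field_simp
  ring

theorem RatPrimrec.sub {f g : α → ℚ} (hf : RatPrimrec f) (hg : RatPrimrec g) :
    RatPrimrec fun a => f a - g a := by
  obtain ⟨c, hc, h⟩ := hf.add hg.neg
  exact ⟨c, hc, fun a => by rw [h]; ring⟩

/-- The sign of f - g is read off its code by comparing the two parts of the numerator, as the
denominator is positive. -/
theorem RatPrimrec.decide_lt {f g : α → ℚ} (hf : RatPrimrec f) (hg : RatPrimrec g) :
    Primrec fun a => decide (f a < g a) := by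
  obtain ⟨c, hc, h⟩ := hf.sub hg
  refine (primrec_decide_lt (f := fun a => (c a).unpair.1.unpair.1)
    (g := fun a => (c a).unpair.1.unpair.2) (by fun_prop) (by fun_prop)).of_eq fun a => ?_
  rw [decide_eq_decide, ← sub_neg (a := f a), ← show _ = f a - g a from h a, Dugundji.nuQ,
    div_lt_iff₀ (by positivity)]
  simp

end Rational

/-! Real-valued functions semicomputable from names -/

section Real

variable {P : Type*} {α β : Type*} [Primcodable α] [Primcodable β] {nm : P → Baire}

/-- The rationals below `t π a` can be enumerated. -/
def LowerSemi (nm : P → Baire) (t : P → α → ℝ) : Prop :=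
  Semi nm fun π (x : α × ℕ) => (nuQ x.2 : ℝ) < t π x.1

/-- The rationals above `t π a` can be enumerated. -/
def UpperSemi (nm : P → Baire) (t : P → α → ℝ) : Prop :=
  Semi nm fun π (x : α × ℕ) => t π x.1 < (nuQ x.2 : ℝ)

theorem RatPrimrec.lowerSemi {g : α → ℚ} (hg : RatPrimrec g) :
    LowerSemi nm fun _ a => (g a : ℝ) :=
  (Semi.of_primrec (RatPrimrec.decide_lt (f := fun x : α × ℕ => Dugundji.nuQ x.2)
    (RatPrimrec.nuQ (by fun_prop)) (hg.comp (f := Prod.fst) (by fun_prop)))).of_iff fun π x => by simp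

theorem RatPrimrec.upperSemi {g : α → ℚ} (hg : RatPrimrec g) :
    UpperSemi nm fun _ a => (g a : ℝ) :=
  (Semi.of_primrec (RatPrimrec.decide_lt (g := fun x : α × ℕ => Dugundji.nuQ x.2)
    (hg.comp (f := Prod.fst) (by fun_prop)) (RatPrimrec.nuQ (by fun_prop)))).of_iff
    fun π x => by simp

theorem exists_nuQ_btwn {x y : ℝ} (h : x < y) : ∃ n, x < (nuQ n : ℝ) ∧ (nuQ n : ℝ) < y := by
  obtain ⟨q, h1, h2⟩ := exists_rat_btwn h
  obtain ⟨n, rfl⟩ := nuQ_surjective q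
  exact ⟨n, h1, h2⟩

/-- A strict inequality is witnessed by a rational number in between. -/
theorem UpperSemi.semi_lt {s t : P → α → ℝ} (hs : UpperSemi nm s) (ht : LowerSemi nm t) :
    Semi nm fun π a => s π a < t π a := by
  refine (Semi.exists (R := fun π n a => s π a < (nuQ n : ℝ) ∧ (nuQ n : ℝ) < t π a)
    (Semi.and (Semi.comp hs (f := fun x : ℕ × α => (x.2, x.1)) (by fun_prop))
      (Semi.comp ht (f := fun x : ℕ × α => (x.2, x.1)) (by fun_prop)))).of_iff fun π a => ?_
  exact ⟨exists_nuQ_btwn, fun ⟨n, h1, h2⟩ => h1.trans h2⟩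

theorem UpperSemi.neg {t : P → α → ℝ} (ht : UpperSemi nm t) :
    LowerSemi nm fun π a => -t π a := by
  obtain ⟨c, hc, h⟩ := (RatPrimrec.nuQ Primrec.id).neg
  refine (Semi.comp ht (f := fun x : α × ℕ => (x.1, c x.2)) (by fun_prop)).of_iff fun π x => ?_
  simp only [h, id, Rat.cast_neg]
  exact lt_neg

theorem LowerSemi.neg {t : P → α → ℝ} (ht : LowerSemi nm t) :
    UpperSemi nm fun π a => -t π a := by
  obtain ⟨c, hc, h⟩ := (RatPrimrec.nuQ Primrec.id).neg
  refine (Semi.comp ht (f := fun x : α × ℕ => (x.1, c x.2)) (by fun_prop)).of_iff fun π x => ?_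
  simp only [h, id, Rat.cast_neg]
  exact neg_lt

theorem UpperSemi.add {s t : P → α → ℝ} (hs : UpperSemi nm s) (ht : UpperSemi nm t) :
    UpperSemi nm fun π a => s π a + t π a := by
  have hd : Primrec fun x : (ℕ × ℕ) × α × ℕ => decide (nuQ x.1.1 + nuQ x.1.2 < nuQ x.2.2) :=
    ((RatPrimrec.nuQ (by fun_prop)).add (RatPrimrec.nuQ (by fun_prop))).decide_lt
      (RatPrimrec.nuQ (by fun_prop))
  refine (Semi.exists (R := fun π (b : ℕ × ℕ) (x : α × ℕ) =>
    (s π x.1 < (nuQ b.1 : ℝ) ∧ t π x.1 < (nuQ b.2 : ℝ)) ∧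
      decide (nuQ b.1 + nuQ b.2 < nuQ x.2) = true) (Semi.and (Semi.and
        (Semi.comp hs (f := fun x : (ℕ × ℕ) × α × ℕ => (x.2.1, x.1.1)) (by fun_prop))
        (Semi.comp ht (f := fun x : (ℕ × ℕ) × α × ℕ => (x.2.1, x.1.2)) (by fun_prop)))
        (Semi.of_primrec hd))).of_iff fun π x => ?_
  simp only [decide_eq_true_eq]
  constructor
  · intro h
    obtain ⟨m, hm1, hm2⟩ := exists_nuQ_btwn (show s π x.1 < nuQ x.2 - t π x.1 by linarith)
    obtain ⟨n, hn1, hn2⟩ := exists_nuQ_btwn (show t π x.1 < nuQ x.2 - nuQ m by linarith)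
    refine ⟨(m, n), ⟨hm1, hn1⟩, ?_⟩
    rw [← Rat.cast_lt (K := ℝ)]
    push_cast
    linarith
  · rintro ⟨⟨m, n⟩, ⟨h1, h2⟩, h3⟩
    rw [← Rat.cast_lt (K := ℝ)] at h3
    push_cast at h3
    simp only at h1 h2 h3
    linarith

theorem LowerSemi.add {s t : P → α → ℝ} (hs : LowerSemi nm s) (ht : LowerSemi nm t) :
    LowerSemi nm fun π a => s π a + t π a :=
  (hs.neg.add ht.neg).neg.of_iff fun π x => by ring_nf

theorem LowerSemi.comp {t : P → α → ℝ} (ht : LowerSemi nm t) {f : β → α} (hf : Primrec f) :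
    LowerSemi nm fun π b => t π (f b) :=
  Semi.comp ht (f := fun x : β × ℕ => (f x.1, x.2)) (by fun_prop)

theorem UpperSemi.comp {t : P → α → ℝ} (ht : UpperSemi nm t) {f : β → α} (hf : Primrec f) :
    UpperSemi nm fun π b => t π (f b) :=
  Semi.comp ht (f := fun x : β × ℕ => (f x.1, x.2)) (by fun_prop)

end Real

/-! Locally finite refinements of sequences of balls -/

section Refinement

variable {X : Type*} [MetricSpace X]

/-- The members of the locally finite refinement of the sequence of balls `B(c n; r n)`. -/
def refinement (c : ℕ → X) (r : ℕ → ℝ) (n : ℕ) : Opens X where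
  carrier := {x | dist x (c n) < r n ∧ ∀ l < n, r l < dist x (c l) + (2 : ℝ)⁻¹ ^ n}
  is_open' := by
    have h : {x | dist x (c n) < r n ∧ ∀ l < n, r l < dist x (c l) + (2 : ℝ)⁻¹ ^ n} =
        {x | dist x (c n) < r n} ∩ ⋂ l ∈ Set.Iio n, {x | r l < dist x (c l) + (2 : ℝ)⁻¹ ^ n} := by
      ext x
      simp
    rw [h]
    refine (isOpen_lt (by fun_prop) (by fun_prop)).inter ((Set.finite_Iio n).isOpen_biInter
      fun l _ => isOpen_lt (by fun_prop) (by fun_prop))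

theorem mem_refinement {c : ℕ → X} {r : ℕ → ℝ} {n : ℕ} {x : X} :
    x ∈ refinement c r n ↔ dist x (c n) < r n ∧ ∀ l < n, r l < dist x (c l) + (2 : ℝ)⁻¹ ^ n :=
  Iff.rfl

/-- The first ball containing x works: x is outside all earlier balls, so no earlier condition
removes it. -/
theorem exists_mem_refinement {c : ℕ → X} {r : ℕ → ℝ} {n : ℕ} {x : X} (h : dist x (c n) < r n) :
    ∃ m, x ∈ refinement c r m := by
  classical
  have hex : ∃ m, dist x (c m) < r m := ⟨n, h⟩
  refine ⟨Nat.find hex, Nat.find_spec hex, fun l hl => ?_⟩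
  have h1 := not_lt.1 (Nat.find_min hex hl)
  have h2 : (0 : ℝ) < 2⁻¹ ^ Nat.find hex := by positivity
  linarith

/-- All points of B(z; s) lie deeper than 2⁻ᴺ in the l-th ball, while members with index at least N
> l contain only points of depth less than 2⁻ᴺ there. -/
theorem lt_of_refinement_meets_ball {c : ℕ → X} {r : ℕ → ℝ} {l N j : ℕ} {z : X} {s : ℝ}
    (hl : l < N) (h : dist z (c l) + s + (2 : ℝ)⁻¹ ^ N < r l)
    (hj : ((refinement c r j : Set X) ∩ Metric.ball z s).Nonempty) : j < N := by
  obtain ⟨x, hx, hxz⟩ := hj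
  by_contra! hN
  have h1 := (mem_refinement.1 hx).2 l (hl.trans_le hN)
  have h2 : (2 : ℝ)⁻¹ ^ j ≤ 2⁻¹ ^ N :=
    pow_le_pow_of_le_one (by norm_num) (by norm_num) hN
  have h3 := dist_triangle x z (c l)
  have h4 := Metric.mem_ball.1 hxz
  linarith

/-- The refinement of a cover of `X \ A` by balls that are small in comparison with their distance
to `A` belongs to a Dugundji system. -/
theorem isDugundjiSystem_refinement {ν : ℕ → X} {A : Closeds X} (hA : (A : Set X).Nonempty)
    {c : ℕ → X} {r : ℕ → ℝ} {y : ℕ → X} (hr : ∀ n, 4 * r n < Metric.infDist (c n) (A : Set X))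
    (hU : (⋃ i, (refinement c r i : Set X)) = (A : Set X)ᶜ) (hyA : ∀ n, y n ∈ A)
    (hy : ∀ n, dist (c n) (y n) < Metric.infDist (c n) (A : Set X) + r n)
    (hLF : LF (shiftNum (ballNum ν)) (refinement c r)) :
    IsDugundjiSystem ν 1 A (refinement c r) y := by
  -- Moving from the centre to x costs at most one of the four radii.
  have hd : ∀ n, ∀ x ∈ refinement c r n, 3 * r n ≤ Metric.infDist x (A : Set X) := by
    intro n x hx
    have h1 := (mem_refinement.1 hx).1
    have h2 := Metric.infDist_le_infDist_add_dist (s := (A : Set X)) (x := c n) (y := x)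
    rw [dist_comm] at h2
    linarith [hr n]
  refine ⟨hA, hLF, hU, hyA, fun n x hx => ?_, fun n hn => ?_⟩
  · have h1 := (mem_refinement.1 hx).1
    have h2 := Metric.infDist_le_infDist_add_dist (s := (A : Set X)) (x := c n) (y := x)
    rw [dist_comm] at h2
    have h3 := dist_triangle x (c n) (y n)
    linarith [hd n x hx, hy n]
  · refine tendsto_of_tendsto_of_tendsto_of_le_of_le tendsto_const_nhds hn (fun _ => zero_le)
      fun i => ?_
    refine Metric.ediam_le fun u hu v hv => ?_
    refine le_iInf₂ fun x hx => le_iInf₂ fun z hz => ?_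
    have hu' := (mem_refinement.1 hu).1
    have hv' := (mem_refinement.1 hv).1
    have h1 := hd (n i) x hx
    have h2 := Metric.infDist_le_dist_of_mem (x := x) hz
    have h3 := dist_triangle_right u v (c (n i))
    have h4 := (dist_nonneg (x := u) (y := c (n i)))
    rw [edist_dist, edist_dist]
    exact ENNReal.ofReal_le_ofReal (by linarith)

end Refinement

/-! Basic balls -/

section Balls

variable {X : Type*} [MetricSpace X] {ν : ℕ → X}

theorem nuQpos_pos (n : ℕ) : 0 < nuQpos n := by
  unfold nuQpos
  positivity

theorem exists_nuQpos_lt {ε : ℝ} (hε : 0 < ε) : ∃ n, (nuQpos n : ℝ) < ε := by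
  obtain ⟨n, hn⟩ := exists_nat_one_div_lt hε
  exact ⟨Nat.pair 0 n, by simpa [nuQpos] using hn⟩

/-- Around each point there are small basic balls. -/
theorem exists_small_ball (hν : DenseRange ν) (x : X) {ε : ℝ} (hε : 0 < ε) :
    ∃ m : ℕ, dist x (ν m.unpair.1) < nuQpos m.unpair.2 ∧ (nuQpos m.unpair.2 : ℝ) < ε := by
  obtain ⟨n, hn⟩ := exists_nuQpos_lt hε
  obtain ⟨i, hi⟩ := hν.exists_dist_lt x (ε := nuQpos n) (by exact_mod_cast nuQpos_pos n)
  exact ⟨Nat.pair i n, by simpa using hi, by simpa using hn⟩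

theorem mem_ballNum {m : ℕ} {x : X} :
    x ∈ ballNum ν m ↔ dist x (ν m.unpair.1) < nuQpos m.unpair.2 := Iff.rfl

/-- A sequence of codes names the union of the enumerated basic balls. -/
theorem iUnion_shiftNum {Y : Type*} {α : ℕ → Set Y} {p : ℕ → ℕ} {E : ℕ → Prop}
    (h : ∀ m, E m ↔ ∃ i, p i = m + 1) : ⋃ i, shiftNum α (p i) = ⋃ (m) (_ : E m), α m := by
  ext x
  simp only [Set.mem_iUnion, h]
  constructor
  · rintro ⟨i, hi⟩
    cases hp : p i with
    | zero => simp [hp, shiftNum] at hi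
    | succ m => exact ⟨m, ⟨i, hp⟩, by simpa [hp, shiftNum] using hi⟩
  · rintro ⟨m, ⟨i, hp⟩, hx⟩
    exact ⟨i, by simpa [hp, shiftNum] using hx⟩

/-- The members of a refinement are unions of basic balls that satisfy finitely many strict
inequalities. -/
theorem refinement_eq_iUnion (hν : DenseRange ν) (c : ℕ → X) (r : ℕ → ℝ) (n : ℕ) :
    (refinement c r n : Set X) = ⋃ (m : ℕ) (_ : dist (ν m.unpair.1) (c n) + nuQpos m.unpair.2 < r n ∧
      ∀ l < n, r l + nuQpos m.unpair.2 < dist (ν m.unpair.1) (c l) + (2 : ℝ)⁻¹ ^ n),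
      ballNum ν m := by
  ext x
  simp only [Set.mem_iUnion, mem_ballNum, SetLike.mem_coe, mem_refinement]
  constructor
  -- ε is a positive lower bound for the slack in the finitely many inequalities. Replacing x by a
  -- centre within the radius, and adding the radius, costs less than twice the radius, hence the
  -- choice ε / 2.
  · rintro ⟨h1, h2⟩
    obtain ⟨ε, hε, hε1, hε2⟩ : ∃ ε : ℝ, 0 < ε ∧ ε ≤ r n - dist x (c n) ∧
        ∀ l < n, ε ≤ dist x (c l) + (2 : ℝ)⁻¹ ^ n - r l := by
      have : ∀ k, ∃ ε : ℝ, 0 < ε ∧ ε ≤ r n - dist x (c n) ∧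
          ∀ l < k, l < n → ε ≤ dist x (c l) + (2 : ℝ)⁻¹ ^ n - r l := by
        intro k
        induction k with
        | zero => exact ⟨r n - dist x (c n), by linarith, le_rfl, by simp⟩
        | succ k ih =>
          obtain ⟨ε, h, h', h''⟩ := ih
          by_cases hk : k < n
          · refine ⟨min ε (dist x (c k) + (2 : ℝ)⁻¹ ^ n - r k), lt_min h (by linarith [h2 k hk]),
              (min_le_left _ _).trans h', fun l hl hln => ?_⟩
            rcases Nat.lt_succ_iff_lt_or_eq.1 hl with hl | rfl
            · exact (min_le_left _ _).trans (h'' l hl hln)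
            · exact min_le_right _ _
          · exact ⟨ε, h, h', fun l hl hln => h'' l (by omega) hln⟩
      obtain ⟨ε, h, h', h''⟩ := this n
      exact ⟨ε, h, h', fun l hl => h'' l hl hl⟩
    obtain ⟨m, hm1, hm2⟩ := exists_small_ball hν x (half_pos hε)
    refine ⟨m, ⟨?_, fun l hl => ?_⟩, hm1⟩
    · linarith [dist_triangle_left (ν m.unpair.1) (c n) x]
    · linarith [dist_triangle x (ν m.unpair.1) (c l), hε2 l hl]
  · rintro ⟨m, ⟨h1, h2⟩, hm⟩
    refine ⟨?_, fun l hl => ?_⟩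
    · linarith [dist_triangle x (ν m.unpair.1) (c n)]
    · linarith [dist_triangle_left (ν m.unpair.1) (c l) x, h2 l hl]

/-- Each point of a ball of the sequence has a basic neighbourhood that is well inside. -/
theorem exists_ball_inside (hν : DenseRange ν) {c : ℕ → X} {r : ℕ → ℝ} {l : ℕ} {x : X}
    (h : dist x (c l) < r l) : ∃ m N : ℕ, x ∈ ballNum ν m ∧ l < N ∧
      dist (ν m.unpair.1) (c l) + nuQpos m.unpair.2 + (2 : ℝ)⁻¹ ^ N < r l := by
  -- Three thirds: moving to the new centre, its radius, and the term 2⁻ᴺ.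
  have hε : 0 < (r l - dist x (c l)) / 3 := by linarith
  obtain ⟨m, hm1, hm2⟩ := exists_small_ball hν x hε
  obtain ⟨N, hN⟩ := exists_pow_lt_of_lt_one hε (show (2 : ℝ)⁻¹ < 1 by norm_num)
  have h2 : (2 : ℝ)⁻¹ ^ (N + l + 1) ≤ 2⁻¹ ^ N :=
    pow_le_pow_of_le_one (by norm_num) (by norm_num) (by omega)
  refine ⟨m, N + l + 1, hm1, by omega, ?_⟩
  linarith [dist_triangle_left (ν m.unpair.1) (c l) x]

end Balls

/-! Distances in a computable metric space -/

section Distances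

variable {X : Type*} [MetricSpace X] {ν : ℕ → X} {P : Type*} {nm : P → Baire}

theorem IsComputableMetricSpace.upperSemi_dist (hν : IsComputableMetricSpace ν) :
    UpperSemi nm fun _ (x : ℕ × ℕ) => dist (ν x.1) (ν x.2) := by
  obtain ⟨-, f, hf, h⟩ := hν
  have hd : Primrec fun y : (ℕ × ℕ) × (ℕ × ℕ) × ℕ =>
      decide (nuQ y.1.2 + 2⁻¹ ^ y.1.1 < nuQ y.2.2) :=
    ((RatPrimrec.nuQ (by fun_prop)).add (RatPrimrec.two_pow_inv (by fun_prop))).decide_lt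
      (RatPrimrec.nuQ (by fun_prop))
  refine (Semi.exists (R := fun _ (b : ℕ × ℕ) (y : (ℕ × ℕ) × ℕ) =>
    f (y.1.1, y.1.2, b.1) = b.2 ∧ decide (nuQ b.2 + 2⁻¹ ^ b.1 < nuQ y.2) = true)
    (Semi.and ((Semi.of_computable hf).comp (f := fun y : (ℕ × ℕ) × (ℕ × ℕ) × ℕ =>
      ((y.2.1.1, y.2.1.2, y.1.1), y.1.2)) (by fun_prop)) (Semi.of_primrec hd))).of_iff
    fun π y => ?_
  simp only [decide_eq_true_eq]
  constructor
  · intro hy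
    -- Half the gap, since the error 2⁻ᵏ enters twice: in the approximation and in the safety margin
    -- of the test.
    obtain ⟨k, hk⟩ := exists_pow_lt_of_lt_one (half_pos (sub_pos.2 hy))
      (show (2 : ℝ)⁻¹ < 1 by norm_num)
    refine ⟨(k, f (y.1.1, y.1.2, k)), rfl, ?_⟩
    have := (abs_lt.1 (h y.1.1 y.1.2 k)).1
    rw [← Rat.cast_lt (K := ℝ)]
    push_cast
    linarith
  · rintro ⟨⟨k, m⟩, hm, hlt⟩
    simp only at hm hlt
    subst hm
    rw [← Rat.cast_lt (K := ℝ)] at hlt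
    push_cast at hlt
    have := (abs_lt.1 (h y.1.1 y.1.2 k)).2
    linarith

theorem IsComputableMetricSpace.lowerSemi_dist (hν : IsComputableMetricSpace ν) :
    LowerSemi nm fun _ (x : ℕ × ℕ) => dist (ν x.1) (ν x.2) := by
  obtain ⟨-, f, hf, h⟩ := hν
  have hd : Primrec fun y : (ℕ × ℕ) × (ℕ × ℕ) × ℕ =>
      decide (nuQ y.2.2 + 2⁻¹ ^ y.1.1 < nuQ y.1.2) :=
    ((RatPrimrec.nuQ (by fun_prop)).add (RatPrimrec.two_pow_inv (by fun_prop))).decide_lt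
      (RatPrimrec.nuQ (by fun_prop))
  refine (Semi.exists (R := fun _ (b : ℕ × ℕ) (y : (ℕ × ℕ) × ℕ) =>
    f (y.1.1, y.1.2, b.1) = b.2 ∧ decide (nuQ y.2 + 2⁻¹ ^ b.1 < nuQ b.2) = true)
    (Semi.and ((Semi.of_computable hf).comp (f := fun y : (ℕ × ℕ) × (ℕ × ℕ) × ℕ =>
      ((y.2.1.1, y.2.1.2, y.1.1), y.1.2)) (by fun_prop)) (Semi.of_primrec hd))).of_iff
    fun π y => ?_
  simp only [decide_eq_true_eq]
  constructor
  · intro hy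
    obtain ⟨k, hk⟩ := exists_pow_lt_of_lt_one (half_pos (sub_pos.2 hy))
      (show (2 : ℝ)⁻¹ < 1 by norm_num)
    refine ⟨(k, f (y.1.1, y.1.2, k)), rfl, ?_⟩
    have := (abs_lt.1 (h y.1.1 y.1.2 k)).2
    rw [← Rat.cast_lt (K := ℝ)]
    push_cast
    linarith
  · rintro ⟨⟨k, m⟩, hm, hlt⟩
    simp only at hm hlt
    subst hm
    rw [← Rat.cast_lt (K := ℝ)] at hlt
    push_cast at hlt
    have := (abs_lt.1 (h y.1.1 y.1.2 k)).1
    linarith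

theorem dist_le_of_cauchyRep {p : Baire} {x : X} (h : cauchyRep ν p x) (k : ℕ) :
    dist (ν (p k)) x ≤ (2 : ℝ)⁻¹ ^ k := by
  refine le_of_tendsto (tendsto_const_nhds.dist h.2) ?_
  filter_upwards [eventually_ge_atTop k] with i hi
  simpa [min_eq_left hi] using (h.1 k i).le

theorem cauchyRep_const (a : ℕ) : cauchyRep ν (fun _ => a) (ν a) :=
  ⟨fun i j => by rw [dist_self]; positivity, tendsto_const_nhds⟩

/-- The distance to the points of a sequence can be approximated from above, uniformly in names
of the points. -/
theorem IsComputableMetricSpace.upperSemi_dist_point (hν : IsComputableMetricSpace ν)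
    {pt : P → ℕ → X} {g : P → ℕ × ℕ → ℕ} (hg : CompFrom nm g)
    (h : ∀ π j, cauchyRep ν (fun k => g π (j, k)) (pt π j)) :
    UpperSemi nm fun π (x : ℕ × ℕ) => dist (ν x.1) (pt π x.2) := by
  have hd : UpperSemi nm fun (_ : P) (y : (ℕ × ℕ) × ℕ) =>
      dist (ν y.1.1) (ν y.1.2) + ((2⁻¹ ^ y.2 : ℚ) : ℝ) :=
    (hν.upperSemi_dist.comp Primrec.fst).add (RatPrimrec.two_pow_inv Primrec.snd).upperSemi
  refine (Semi.exists (R := fun π (b : ℕ × ℕ) (y : (ℕ × ℕ) × ℕ) => g π (y.1.2, b.1) = b.2 ∧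
    dist (ν y.1.1) (ν b.2) + ((2⁻¹ ^ b.1 : ℚ) : ℝ) < nuQ y.2)
    (Semi.and (Semi.comp hg (f := fun z : (ℕ × ℕ) × (ℕ × ℕ) × ℕ =>
      ((z.2.1.2, z.1.1), z.1.2)) (by fun_prop))
      (Semi.comp hd (f := fun z : (ℕ × ℕ) × (ℕ × ℕ) × ℕ =>
      (((z.2.1.1, z.1.2), z.1.1), z.2.2)) (by fun_prop)))).of_iff fun π y => ?_
  push_cast
  constructor
  · intro hy
    obtain ⟨k, hk⟩ := exists_pow_lt_of_lt_one (half_pos (sub_pos.2 hy))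
      (show (2 : ℝ)⁻¹ < 1 by norm_num)
    refine ⟨(k, g π (y.1.2, k)), rfl, ?_⟩
    have h1 := dist_le_of_cauchyRep (h π y.1.2) k
    have h2 := dist_triangle_right (ν y.1.1) (ν (g π (y.1.2, k))) (pt π y.1.2)
    linarith
  · rintro ⟨⟨k, m⟩, hm, hlt⟩
    simp only at hm hlt
    subst hm
    have h1 := dist_le_of_cauchyRep (h π y.1.2) k
    have h2 := dist_triangle (ν y.1.1) (ν (g π (y.1.2, k))) (pt π y.1.2)
    linarith

/-- The associate stores output values plus one, so the output n + 1, which itself lists the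
rational with index n, appears as n + 2. -/
theorem eta_apply {p r q : Baire} (h : q ∈ eta p r) (i n : ℕ) :
    q i = n + 1 ↔ ∃ k, p (Nat.pair i (Encodable.encode (word r k))) = n + 2 ∧
      ∀ j < k, p (Nat.pair i (Encodable.encode (word r j))) = 0 := by
  obtain ⟨hd, rfl⟩ := h
  simp only [eta]
  constructor
  · intro hq
    refine ⟨Nat.find (hd i), by omega, fun j hj => ?_⟩
    simpa using Nat.find_min (hd i) hj
  · rintro ⟨k, hk, hlt⟩
    have : Nat.find (hd i) = k := by
      rw [Nat.find_eq_iff]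
      exact ⟨by omega, fun j hj => by simp [hlt j hj]⟩
    rw [this, hk]
    rfl

/-- The distance to a nonempty set can be approximated from below, uniformly in `distRep`-names
of the set. -/
theorem lowerSemi_infDist {A : P → Closeds X} (hA : ∀ π, (A π : Set X).Nonempty)
    {g : P → ℕ → ℕ} (hg : CompFrom nm g) (h : ∀ π, distRep ν (g π) (A π)) :
    LowerSemi nm fun π a => Metric.infDist (ν a) (A π : Set X) := by
  have hval : Semi nm fun π (z : ((ℕ × ℕ) × ℕ) × ℕ) =>
      g π (Nat.pair z.1.1.1 (Encodable.encode (List.replicate z.1.1.2 z.1.2))) = z.2 :=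
    Semi.comp hg (f := fun z : ((ℕ × ℕ) × ℕ) × ℕ =>
      (Nat.pair z.1.1.1 (Encodable.encode (List.replicate z.1.1.2 z.1.2)), z.2)) (by fun_prop)
  refine (Semi.exists (R := fun π (b : ℕ × ℕ) (x : ℕ × ℕ) =>
    g π (Nat.pair b.1 (Encodable.encode (List.replicate b.2 x.1))) = x.2 + 2 ∧
      ∀ j < b.2, g π (Nat.pair b.1 (Encodable.encode (List.replicate j x.1))) = 0)
    (Semi.and (hval.comp (f := fun z : (ℕ × ℕ) × ℕ × ℕ => ((z.1, z.2.1), z.2.2 + 2))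
        (by fun_prop)) (Semi.forall_lt
      (hval.comp (f := fun z : ℕ × (ℕ × ℕ) × ℕ × ℕ => (((z.2.1.1, z.1), z.2.2.1), 0))
        (by fun_prop)) (f := fun y : (ℕ × ℕ) × ℕ × ℕ => y.1.2) (by fun_prop)))).of_iff
    fun π x => ?_
  -- The realizer is run on the constant name of ν a, whose prefixes are explicit.
  obtain ⟨q, hq, hqA⟩ := h π _ _ (cauchyRep_const (ν := ν) x.1)
  have hfin := Metric.infEDist_ne_top (x := ν x.1) (hA π)
  have h1 : (nuQ x.2 : ℝ) < Metric.infDist (ν x.1) (A π : Set X) ↔ ∃ i, q i = x.2 + 1 := by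
    have h2 : x.2 ∈ {n | ((nuQ n : ℝ) : EReal) <
        ((Metric.infEDist (ν x.1) (A π : Set X) : ENNReal) : EReal)} ↔
        x.2 ∈ {n | ∃ i, q i = n + 1} := by rw [hqA]
    simp only [Set.mem_ofPred_eq] at h2
    rw [← h2, ← ENNReal.ofReal_toReal hfin, EReal.coe_ennreal_ofReal,
      max_eq_left ENNReal.toReal_nonneg, EReal.coe_lt_coe_iff]
    rfl
  rw [h1]
  simp only [eta_apply hq, Prod.exists]
  have hw : ∀ k, word (fun _ => x.1) k = List.replicate k x.1 := fun k => by simp [word]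
  simp only [hw]

end Distances

/-! The reductions -/

section Reductions

variable {X : Type*} [MetricSpace X] {ν : ℕ → X}

/-- The points of a Dugundji system for `A` are dense in a set that contains the boundary
of `A`. -/
theorem frontier_subset_closure_range {ε : ℝ} {A : Closeds X} {V : ℕ → Opens X} {y : ℕ → X}
    (h : IsDugundjiSystem ν ε A V y) : frontier (A : Set X) ⊆ closure (Set.range y) := by
  obtain ⟨-, -, hU, -, hy, -⟩ := h
  intro x hx
  rw [frontier_eq_closure_inter_closure] at hx
  have hxA : x ∈ (A : Set X) := A.isClosed.closure_eq ▸ hx.1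
  rw [Metric.mem_closure_iff]
  intro δ hδ
  have hpos : 0 < 2 + |ε| := by positivity
  -- d(x, y_i) ≤ d(x, z) + (1 + ε) d(z, A) ≤ (2 + |ε|) d(x, z); the absolute value allows any sign
  -- of ε.
  obtain ⟨z, hz, hxz⟩ := Metric.mem_closure_iff.1 hx.2 (δ / (2 + |ε|)) (by positivity)
  rw [← hU] at hz
  obtain ⟨i, hi⟩ := Set.mem_iUnion.1 hz
  refine ⟨y i, ⟨i, rfl⟩, ?_⟩
  have h1 := hy i z hi
  have h2 := Metric.infDist_le_dist_of_mem (x := z) hxA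
  rw [dist_comm] at h2
  have h0 := Metric.infDist_nonneg (x := z) (s := (A : Set X))
  have h3 : (1 + ε) * Metric.infDist z (A : Set X) ≤ (1 + |ε|) * dist x z :=
    mul_le_mul (by linarith [le_abs_self ε]) h2 h0 (by positivity)
  have h4 : (2 + |ε|) * dist x z < δ := by
    rwa [lt_div_iff₀ hpos, mul_comm] at hxz
  linarith [dist_triangle x z (y i)]

/-- Even entries copy the names of the y_i, raised by one as `rangeRep` demands, and name B =
closure {y_i}. Odd entries copy the exact ball cover of X \ A. -/
theorem delta4_reducible_delta8 (ν : ℕ → X) :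
    Rep.Reducible ((delta4 ν).restrict (properClosed X))
      ((delta8 ν).restrict (properClosed X)) := by
  refine Rep.Reducible.of_compFrom (G := fun x n =>
    bif decide (n % 2 = 0) then x.1.1 (n + 1) + 1 else x.1.1 (2 * (3 * (n / 2) + 1))) ?_ ?_
  · refine CompFrom.cond (by fun_prop) ?_ ?_
    · exact (CompFrom.of_primrec (f := fun n => n + 1) (by fun_prop)).comp
        (CompFrom.entry.comp (CompFrom.of_primrec (f := fun n => n + 1) (by fun_prop)))
    · exact CompFrom.entry.comp
        (CompFrom.of_primrec (f := fun n => 2 * (3 * (n / 2) + 1)) (by fun_prop))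
  · rintro ⟨⟨s, A⟩, h⟩
    change (delta8 ν).restrict (properClosed X) (fun n => bif decide (n % 2 = 0) then
      s (n + 1) + 1 else s (2 * (3 * (n / 2) + 1))) A
    obtain ⟨hAp, ⟨V, y⟩, -, rfl, hD, ⟨-, hU⟩, hy⟩ := h
    have hfr := frontier_subset_closure_range hD
    obtain ⟨hA, -, hVU, hyA, -, -⟩ := hD
    refine ⟨hAp, hA, ⟨⟨closure (Set.range y), isClosed_closure⟩, hfr, ?_, Or.inr ⟨?_, ?_, ?_⟩⟩, ?_⟩
    · exact closure_minimal (Set.range_subset_iff.2 hyA) (Closeds.isClosed _)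
    · exact ⟨y 0, subset_closure ⟨0, rfl⟩⟩
    · intro i
      refine ⟨y i, subset_closure ⟨i, rfl⟩, _, fun k => ?_, hy i⟩
      simp [projω, proj2]
    · intro x hx U hU hxU
      obtain ⟨_, hyU, i, rfl⟩ := mem_closure_iff.1 hx U hU hxU
      refine ⟨i, y i, hyU, _, fun k => ?_, hy i⟩
      simp [projω, proj2]
    · have h1 : proj2 (fun n => bif decide (n % 2 = 0) then s (n + 1) + 1
          else s (2 * (3 * (n / 2) + 1))) 1 = proj3 (proj2 s 0) 1 := by
        funext n
        have h2 : (2 * n + 1) / 2 = n := by omega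
        simp [proj2, proj3, h2]
      change ((Closeds.compl _ : Opens X) : Set X) = ⋃ i, shiftNum (ballNum ν) (proj2 _ 1 i)
      rw [h1, ← hU, hVU]
      rfl

end Reductions

/-! ### Computing a Dugundji system from a dense sequence and lower bounds on the distance -/

section Construction

variable {X : Type*} [MetricSpace X] {ν : ℕ → X}

/-- The ball with index `m` is small in comparison with its distance to `A`. -/
def SmallBall (ν : ℕ → X) (A : Closeds X) (m : ℕ) : Prop :=
  4 * (nuQpos m.unpair.2 : ℝ) < Metric.infDist (ν m.unpair.1) (A : Set X)

theorem exists_smallBall (hν : DenseRange ν) {A : Closeds X} (hA : (A : Set X).Nonempty) {x : X}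
    (hx : x ∉ A) : ∃ m, x ∈ ballNum ν m ∧ SmallBall ν A m := by
  have hpos : 0 < Metric.infDist x (A : Set X) :=
    (A.isClosed.notMem_iff_infDist_pos hA).1 hx
  obtain ⟨m, hm1, hm2⟩ := exists_small_ball hν x
    -- Passing from x to the centre loses at most one radius, leaving more than 5r - r = 4r.
    (show 0 < Metric.infDist x (A : Set X) / 5 by linarith)
  refine ⟨m, hm1, ?_⟩
  have h := Metric.infDist_le_infDist_add_dist (s := (A : Set X)) (x := x) (y := ν m.unpair.1)
  unfold SmallBall
  linarith

theorem SmallBall.notMem {A : Closeds X} {m : ℕ} (h : SmallBall ν A m) {x : X}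
    (hx : x ∈ ballNum ν m) : x ∉ A := by
  intro hxA
  have h1 := Metric.infDist_le_dist_of_mem (x := ν m.unpair.1) hxA
  rw [mem_ballNum, dist_comm] at hx
  have h2 : (0 : ℝ) < nuQpos m.unpair.2 := by exact_mod_cast nuQpos_pos _
  unfold SmallBall at h
  linarith

theorem iUnion_refinement_smallBall (hν : DenseRange ν) {A : Closeds X}
    (hA : (A : Set X).Nonempty) {b : ℕ → ℕ} (hb : ∀ m, SmallBall ν A m ↔ ∃ i, b i = m) :
    (⋃ i, (refinement (fun n => ν (b n).unpair.1) (fun n => (nuQpos (b n).unpair.2 : ℝ)) i :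
      Set X)) = (A : Set X)ᶜ := by
  ext x
  simp only [Set.mem_iUnion, SetLike.mem_coe, Set.mem_compl_iff]
  constructor
  · rintro ⟨i, hi⟩
    exact ((hb _).2 ⟨i, rfl⟩).notMem (mem_refinement.1 hi).1
  · intro hx
    obtain ⟨m, hm, hs⟩ := exists_smallBall hν hA hx
    obtain ⟨i, rfl⟩ := (hb m).1 hs
    exact exists_mem_refinement (n := i) hm

variable {P : Type*} {nm : P → Baire}

theorem RatPrimrec.radius {α : Type*} [Primcodable α] {f : α → ℕ} (hf : Primrec f) :
    RatPrimrec fun a => Dugundji.nuQpos (f a).unpair.2 :=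
  RatPrimrec.nuQpos (by fun_prop)

/-- The small balls can be enumerated. -/
theorem exists_enumeration_smallBall (hν : DenseRange ν) {A : P → Closeds X}
    (hA : ∀ π, A π ∈ properClosed X)
    (hd : LowerSemi nm fun π a => Metric.infDist (ν a) (A π : Set X)) :
    ∃ b : P → ℕ → ℕ, CompFrom nm b ∧ ∀ π m, SmallBall ν (A π) m ↔ ∃ i, b π i = m := by
  have h1 : Semi nm fun π m => SmallBall ν (A π) m := by
    have hr := RatPrimrec.radius (f := fun m : ℕ => m) Primrec.id
    refine ((((hr.add hr).add (hr.add hr)).upperSemi (nm := nm)).semi_lt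
      (hd.comp (f := fun m : ℕ => m.unpair.1) (by fun_prop))).of_iff fun π m => ?_
    unfold SmallBall
    push_cast
    ring_nf
  obtain ⟨e, he, h⟩ := Semi.enumerate (E := fun π (_ : Unit) m => SmallBall ν (A π) m)
    (h1.comp (f := fun x : Unit × ℕ => x.2) (by fun_prop)) fun π _ => by
      -- A ≠ X guarantees that there is at least one ball to enumerate.
      obtain ⟨x, hx⟩ := (Set.ne_univ_iff_exists_notMem _).1 (hA π).2
      obtain ⟨m, -, hm⟩ := exists_smallBall hν (Set.nonempty_iff_ne_empty.2 (hA π).1) hx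
      exact ⟨m, hm⟩
  exact ⟨fun π n => e π ((), n), he.comp (CompFrom.of_primrec (f := fun n : ℕ => ((), n))
    (by fun_prop)), fun π m => h π () m⟩

/-- A nearly closest point among a dense sequence of points of `A` can be selected. -/
theorem exists_selection (hν : IsComputableMetricSpace ν) {A : P → Closeds X}
    (hA : ∀ π, (A π : Set X).Nonempty)
    (hd : LowerSemi nm fun π a => Metric.infDist (ν a) (A π : Set X)) {pt : P → ℕ → X}
    {g : P → ℕ × ℕ → ℕ} (hg : CompFrom nm g)
    (hpt : ∀ π j, cauchyRep ν (fun k => g π (j, k)) (pt π j))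
    (hdense : ∀ π, (A π : Set X) ⊆ closure (Set.range (pt π))) :
    ∃ J : P → ℕ → ℕ, CompFrom nm J ∧ ∀ π (m : ℕ), dist (ν m.unpair.1) (pt π (J π m)) <
      Metric.infDist (ν m.unpair.1) (A π : Set X) + nuQpos m.unpair.2 := by
  -- The positive slack makes a choice always possible. The left side is approximable from above and
  -- the right side from below, so the search succeeds.
  refine Semi.uniformize (R := fun π (m j : ℕ) => dist (ν m.unpair.1) (pt π j) <
    Metric.infDist (ν m.unpair.1) (A π : Set X) + nuQpos m.unpair.2) ?_ fun π m => ?_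
  · exact ((hν.upperSemi_dist_point hg hpt).comp (f := fun x : ℕ × ℕ => (x.1.unpair.1, x.2))
      (by fun_prop)).semi_lt ((hd.comp (f := fun x : ℕ × ℕ => x.1.unpair.1) (by fun_prop)).add
      (RatPrimrec.radius (by fun_prop)).lowerSemi)
  · have hpos : (0 : ℝ) < nuQpos m.unpair.2 := by exact_mod_cast nuQpos_pos _
    obtain ⟨y, hy, hlt⟩ := (Metric.infDist_lt_iff (hA π)).1 (lt_add_of_pos_right
      (Metric.infDist (ν m.unpair.1) (A π : Set X)) hpos)
    obtain ⟨_, ⟨j, rfl⟩, hj⟩ := Metric.mem_closure_iff.1 (hdense π hy) _ (sub_pos.2 hlt)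
    exact ⟨j, by linarith [dist_triangle (ν m.unpair.1) y (pt π j)]⟩

/-- The members of the refinement can be named. -/
theorem exists_names_refinement (hν : IsComputableMetricSpace ν) {b : P → ℕ → ℕ}
    (hb : CompFrom nm b) : ∃ e : P → ℕ × ℕ → ℕ, CompFrom nm e ∧ ∀ π n,
      (refinement (fun n => ν (b π n).unpair.1) (fun n => (nuQpos (b π n).unpair.2 : ℝ)) n :
        Set X) = ⋃ i, shiftNum (ballNum ν) (e π (n, i)) := by
  let E : P → ℕ → ℕ → Prop := fun π n m =>
    dist (ν m.unpair.1) (ν (b π n).unpair.1) + nuQpos m.unpair.2 < nuQpos (b π n).unpair.2 ∧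
      ∀ l < n, (nuQpos (b π l).unpair.2 : ℝ) + nuQpos m.unpair.2 <
        dist (ν m.unpair.1) (ν (b π l).unpair.1) + (2 : ℝ)⁻¹ ^ n
  have h1 : Semi nm fun _ (u : ℕ × ℕ) => dist (ν u.1.unpair.1) (ν u.2.unpair.1) +
      (nuQpos u.1.unpair.2 : ℝ) < nuQpos u.2.unpair.2 :=
    ((hν.upperSemi_dist.comp (f := fun u : ℕ × ℕ => (u.1.unpair.1, u.2.unpair.1))
      (by fun_prop)).add (RatPrimrec.radius (by fun_prop)).upperSemi).semi_lt
      (RatPrimrec.radius (by fun_prop)).lowerSemi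
  have h2 : Semi nm fun _ (u : (ℕ × ℕ) × ℕ) => (nuQpos u.1.2.unpair.2 : ℝ) +
      nuQpos u.1.1.unpair.2 < dist (ν u.1.1.unpair.1) (ν u.1.2.unpair.1) +
        ((2⁻¹ ^ u.2 : ℚ) : ℝ) :=
    (((RatPrimrec.radius (by fun_prop)).upperSemi).add
      (RatPrimrec.radius (by fun_prop)).upperSemi).semi_lt
      ((hν.lowerSemi_dist.comp (f := fun u : (ℕ × ℕ) × ℕ => (u.1.1.unpair.1, u.1.2.unpair.1))
      (by fun_prop)).add (RatPrimrec.two_pow_inv (by fun_prop)).lowerSemi)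
  have hE : Semi nm fun π (x : ℕ × ℕ) => E π x.1 x.2 := by
    refine (h1.subst (G := fun π (x : ℕ × ℕ) => (x.2, b π x.1))
      ((CompFrom.of_primrec (by fun_prop)).pair (hb.comp (CompFrom.of_primrec (by fun_prop))))).and
      (Semi.forall_lt (R := fun π l (x : ℕ × ℕ) => (nuQpos (b π l).unpair.2 : ℝ) +
        nuQpos x.2.unpair.2 < dist (ν x.2.unpair.1) (ν (b π l).unpair.1) + (2 : ℝ)⁻¹ ^ x.1)
        ((h2.subst (G := fun π (y : ℕ × ℕ × ℕ) => ((y.2.2, b π y.1), y.2.1))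
      (((CompFrom.of_primrec (by fun_prop)).pair
        (hb.comp (CompFrom.of_primrec (by fun_prop)))).pair
        (CompFrom.of_primrec (by fun_prop)))).of_iff fun π y => by push_cast; rfl) (by fun_prop))
  -- A member may be empty; the code 0 of ∅ keeps the enumerated set nonempty.
  obtain ⟨e, he, h⟩ := Semi.enumerate (E := fun π n m => m = 0 ∨ E π n (m - 1))
    (((Semi.of_primrec (c := fun x : ℕ × ℕ => decide (x.2 = 0)) (by fun_prop)).or
      (hE.comp (f := fun x : ℕ × ℕ => (x.1, x.2 - 1)) (by fun_prop))).of_iff fun π x => by simp)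
    fun π n => ⟨0, Or.inl rfl⟩
  refine ⟨e, he, fun π n => ?_⟩
  rw [refinement_eq_iUnion hν.1, iUnion_shiftNum (E := E π n) fun m => ?_]
  rw [← h π n (m + 1)]
  simp

/-- Basic balls that meet only finitely many members of the refinement can be enumerated. -/
theorem exists_cover_refinement (hν : IsComputableMetricSpace ν) {b : P → ℕ → ℕ}
    (hb : CompFrom nm b) : ∃ e : P → ℕ → ℕ × ℕ, CompFrom nm e ∧ ∀ π m N,
      (∃ i, e π i = (m + 1, N)) ↔ ∃ l < N, dist (ν m.unpair.1) (ν (b π l).unpair.1) +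
        nuQpos m.unpair.2 + (2 : ℝ)⁻¹ ^ N < nuQpos (b π l).unpair.2 := by
  let E : P → ℕ → ℕ → Prop := fun π m N => ∃ l, l < N ∧
    dist (ν m.unpair.1) (ν (b π l).unpair.1) + nuQpos m.unpair.2 + (2 : ℝ)⁻¹ ^ N <
      nuQpos (b π l).unpair.2
  have h1 : Semi nm fun _ (u : (ℕ × ℕ) × ℕ) => dist (ν u.1.1.unpair.1) (ν u.1.2.unpair.1) +
      (nuQpos u.1.1.unpair.2 : ℝ) + ((2⁻¹ ^ u.2 : ℚ) : ℝ) < nuQpos u.1.2.unpair.2 :=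
    (((hν.upperSemi_dist.comp (f := fun u : (ℕ × ℕ) × ℕ => (u.1.1.unpair.1, u.1.2.unpair.1))
      (by fun_prop)).add (RatPrimrec.radius (by fun_prop)).upperSemi).add
      (RatPrimrec.two_pow_inv (by fun_prop)).upperSemi).semi_lt
      (RatPrimrec.radius (by fun_prop)).lowerSemi
  have hE : Semi nm fun π (x : ℕ × ℕ) => E π x.1 x.2 := by
    refine Semi.exists (R := fun π l (x : ℕ × ℕ) => l < x.2 ∧
      dist (ν x.1.unpair.1) (ν (b π l).unpair.1) + nuQpos x.1.unpair.2 + (2 : ℝ)⁻¹ ^ x.2 <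
      nuQpos (b π l).unpair.2) (Semi.and ((Semi.of_primrec (c := fun y : ℕ × ℕ × ℕ =>
        decide (y.1 < y.2.2)) (by fun_prop)).of_iff fun π y => by simp)
        ((h1.subst (G := fun π (y : ℕ × ℕ × ℕ) => ((y.2.1, b π y.1), y.2.2))
      (((CompFrom.of_primrec (by fun_prop)).pair
        (hb.comp (CompFrom.of_primrec (by fun_prop)))).pair
        (CompFrom.of_primrec (by fun_prop)))).of_iff fun π y => by push_cast; rfl))
  obtain ⟨e, he, h⟩ := Semi.enumerate (E := fun π (_ : Unit) (x : ℕ × ℕ) =>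
      x.1 = 0 ∨ E π (x.1 - 1) x.2)
    (((Semi.of_primrec (c := fun x : Unit × ℕ × ℕ => decide (x.2.1 = 0)) (by fun_prop)).or
      (hE.comp (f := fun x : Unit × ℕ × ℕ => (x.2.1 - 1, x.2.2)) (by fun_prop))).of_iff
      fun π x => by simp)
    fun π n => ⟨(0, 0), Or.inl rfl⟩
  refine ⟨fun π n => e π ((), n), he.comp (CompFrom.of_primrec (by fun_prop)), fun π m N => ?_⟩
  rw [← h π () (m + 1, N)]
  simp [E]

/-- The name of a Dugundji system with the given components. -/
def assembleName (e : ℕ × ℕ → ℕ) (t : ℕ → ℕ × ℕ) (g : ℕ × ℕ → ℕ) : Baire := fun n =>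
  bif decide (n % 2 = 0) then
    (bif decide (n / 2 % 3 = 0) then e (n / 2 / 3).unpair else
      (bif decide (n / 2 % 3 = 1) then (t (n / 2 / 3)).1 else 2 ^ (t (n / 2 / 3)).2 - 1))
  else g (n / 2).unpair

section assembleName

variable (e : ℕ × ℕ → ℕ) (t : ℕ → ℕ × ℕ) (g : ℕ × ℕ → ℕ)

theorem assembleName_cover (n i : ℕ) :
    projω (proj3 (proj2 (assembleName e t g) 0) 0) n i = e (n, i) := by
  simp [projω, proj3, proj2, assembleName]

theorem assembleName_ball (n : ℕ) :
    proj3 (proj2 (assembleName e t g) 0) 1 n = (t n).1 := by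
  have h1 : (3 * n + 1) % 3 = 1 := by omega
  have h2 : (3 * n + 1) / 3 = n := by omega
  simp [proj3, proj2, assembleName, h1, h2]

theorem assembleName_code (n : ℕ) :
    proj3 (proj2 (assembleName e t g) 0) 2 n = 2 ^ (t n).2 - 1 := by
  have h1 : (3 * n + 2) % 3 = 2 := by omega
  have h2 : (3 * n + 2) / 3 = n := by omega
  simp [proj3, proj2, assembleName, h1, h2]

theorem assembleName_point (n i : ℕ) :
    projω (proj2 (assembleName e t g) 1) n i = g (n, i) := by
  have h1 : (2 * Nat.pair n i + 1) / 2 = Nat.pair n i := by omega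
  simp [projω, proj2, assembleName, h1]

end assembleName

theorem CompFrom.assembleName {e : P → ℕ × ℕ → ℕ} {t : P → ℕ → ℕ × ℕ} {g : P → ℕ × ℕ → ℕ}
    (he : CompFrom nm e) (ht : CompFrom nm t) (hg : CompFrom nm g) :
    CompFrom nm fun π => Dugundji.assembleName (e π) (t π) (g π) := by
  have ht' : CompFrom nm fun π n => t π (n / 2 / 3) :=
    ht.comp (CompFrom.of_primrec (f := fun n : ℕ => n / 2 / 3) (by fun_prop))
  refine CompFrom.cond (by fun_prop) (CompFrom.cond (by fun_prop) ?_
    (CompFrom.cond (by fun_prop) ?_ ?_)) ?_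
  · exact he.comp (CompFrom.of_primrec (f := fun n : ℕ => (n / 2 / 3).unpair) (by fun_prop))
  · exact (CompFrom.of_primrec (f := fun x : ℕ × ℕ => x.1) (by fun_prop)).comp ht'
  · exact (CompFrom.of_primrec (f := fun x : ℕ × ℕ => 2 ^ x.2 - 1) (by fun_prop)).comp ht'
  · exact hg.comp (CompFrom.of_primrec (f := fun n : ℕ => (n / 2).unpair) (by fun_prop))

/-- The components produced from a set `A` form a name of `A`. -/
theorem delta4_assembleName (hν : DenseRange ν) {A : Closeds X} (hA : (A : Set X).Nonempty)
    {b : ℕ → ℕ} (hb : ∀ m, SmallBall ν A m ↔ ∃ i, b i = m) {y : ℕ → X} (hyA : ∀ n, y n ∈ A)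
    (hy : ∀ n, dist (ν (b n).unpair.1) (y n) <
      Metric.infDist (ν (b n).unpair.1) (A : Set X) + nuQpos (b n).unpair.2)
    {e : ℕ × ℕ → ℕ} (he : ∀ n, (refinement (fun n => ν (b n).unpair.1)
      (fun n => (nuQpos (b n).unpair.2 : ℝ)) n : Set X) = ⋃ i, shiftNum (ballNum ν) (e (n, i)))
    {t : ℕ → ℕ × ℕ} (ht : ∀ m N, (∃ i, t i = (m + 1, N)) ↔ ∃ l < N,
      dist (ν m.unpair.1) (ν (b l).unpair.1) + nuQpos m.unpair.2 + (2 : ℝ)⁻¹ ^ N <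
        nuQpos (b l).unpair.2)
    {g : ℕ × ℕ → ℕ} (hg : ∀ n, cauchyRep ν (fun k => g (n, k)) (y n)) :
    delta4 ν (assembleName e t g) A := by
  set c : ℕ → X := fun n => ν (b n).unpair.1 with hc
  set r : ℕ → ℝ := fun n => (nuQpos (b n).unpair.2 : ℝ) with hr
  have hU : (⋃ i, (refinement c r i : Set X)) = (A : Set X)ᶜ :=
    iUnion_refinement_smallBall hν hA hb
  have hfin : ∀ {m N l j : ℕ}, l < N → dist (ν m.unpair.1) (ν (b l).unpair.1) +
      nuQpos m.unpair.2 + (2 : ℝ)⁻¹ ^ N < nuQpos (b l).unpair.2 →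
      ((refinement c r j : Set X) ∩ ballNum ν m).Nonempty → j < N := fun hl h hj =>
    lt_of_refinement_meets_ball (c := c) (r := r) hl h hj
  have hcov : ∀ {x}, x ∉ A → ∃ m N l : ℕ, x ∈ ballNum ν m ∧ l < N ∧
      dist (ν m.unpair.1) (ν (b l).unpair.1) + nuQpos m.unpair.2 + (2 : ℝ)⁻¹ ^ N <
        nuQpos (b l).unpair.2 := by
    intro x hx
    obtain ⟨m, hm, hs⟩ := exists_smallBall hν hA hx
    obtain ⟨l, rfl⟩ := (hb m).1 hs
    obtain ⟨m, N, h⟩ := exists_ball_inside hν (c := c) (r := r) (l := l) hm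
    exact ⟨m, N, l, h⟩
  have hnot : ∀ {x i}, x ∈ refinement c r i → x ∉ A := fun {x i} hx => by
    have : x ∈ (A : Set X)ᶜ := hU ▸ Set.mem_iUnion_of_mem i hx
    exact this
  have hLF : LF (shiftNum (ballNum ν)) (refinement c r) := by
    intro x i hx
    obtain ⟨m, N, l, hm, hl, h⟩ := hcov (hnot hx)
    exact ⟨m + 1, Finset.range N, hm, fun j hj => Finset.mem_coe.2 (Finset.mem_range.2
      (hfin hl h hj))⟩
  have hpi : piSet (refinement c r, y) = A := by
    refine SetLike.coe_injective ?_
    change ((⨆ i, refinement c r i : Opens X) : Set X)ᶜ = A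
    rw [Opens.coe_iSup, hU, compl_compl]
  have hD : IsDugundjiSystem ν 1 A (refinement c r) y :=
    isDugundjiSystem_refinement hA (fun n => (hb _).2 ⟨n, rfl⟩) hU hyA hy hLF
  have hsys : (refinement c r, y) ∈ systems ν := by
    change IsDugundjiSystem ν 1 (piSet (refinement c r, y)) _ _
    rwa [hpi]
  have hballs : (⋃ j, (refinement c r j : Set X)) =
      ⋃ i, shiftNum (ballNum ν) (proj3 (proj2 (assembleName e t g) 0) 1 i) := by
    ext x
    simp only [assembleName_ball]
    constructor
    · intro hx
      obtain ⟨i, hi⟩ := Set.mem_iUnion.1 hx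
      obtain ⟨m, N, l, hm, hl, h⟩ := hcov (hnot hi)
      obtain ⟨i, hi⟩ := (ht m N).2 ⟨l, hl, h⟩
      exact Set.mem_iUnion.2 ⟨i, by rw [hi]; exact hm⟩
    -- Each listed ball lies inside some ball of the original sequence, so the cover is exact.
    · intro hx
      obtain ⟨i, hi⟩ := Set.mem_iUnion.1 hx
      rcases hti : t i with ⟨_ | m, N⟩
      · simp [hti, shiftNum] at hi
      · rw [hti] at hi
        obtain ⟨l, -, h⟩ := (ht m N).1 ⟨i, hti⟩
        have hx' : x ∈ Metric.ball (ν m.unpair.1) (nuQpos m.unpair.2 : ℝ) := hi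
        have h1 := Metric.mem_ball.1 hx'
        have h2 := dist_triangle x (ν m.unpair.1) (c l)
        have h3 : (0 : ℝ) < 2⁻¹ ^ N := by positivity
        obtain ⟨k, hk⟩ := exists_mem_refinement (c := c) (r := r) (n := l) (x := x) (by
          simp only [hc, hr] at h2 ⊢
          linarith)
        exact Set.mem_iUnion.2 ⟨k, hk⟩
  refine ⟨_, hsys, hpi, hsys, ⟨⟨hLF, fun n => ?_, hballs.le, fun i => ?_⟩, hballs⟩, fun n => ?_⟩
  · change (refinement c r n : Set X) = _
    simp only [assembleName_cover]
    exact he n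
  · rw [assembleName_ball, assembleName_code]
    intro j hj
    rcases hti : t i with ⟨_ | m, N⟩
    · simp [hti, shiftNum] at hj
    · obtain ⟨l, hl, h⟩ := (ht m N).1 ⟨i, hti⟩
      simp only [hti, shiftNum] at hj
      -- 2 ^ N - 1 is the binary code of {0, …, N - 1}.
      simpa [Nat.testBit_two_pow_sub_one] using hfin hl h hj
  · have h : projω (proj2 (assembleName e t g) 1) n = fun k => g (n, k) := by
      funext k
      exact assembleName_point e t g n k
    rw [h]
    exact hg n

theorem range_dist_reducible_delta4 (hν : IsComputableMetricSpace ν) :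
    Rep.Reducible (((rangeRep ν).meet (distRep ν)).restrict (properClosed X))
      ((delta4 ν).restrict (properClosed X)) := by
  let P := {x : Baire × Closeds X //
    ((rangeRep ν).meet (distRep ν)).restrict (properClosed X) x.1 x.2}
  let nm : P → Baire := fun x => x.1.1
  let A : P → Closeds X := fun x => x.1.2
  have hA : ∀ π, A π ∈ properClosed X := fun π => π.2.1
  have hA' : ∀ π, (A π : Set X).Nonempty := fun π => Set.nonempty_iff_ne_empty.2 (hA π).1
  have hrange : ∀ π : P, _ := fun π => π.2.2.1.resolve_left fun h => (hA π).1 h.1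
  have hex : ∀ (π : P) (j : ℕ), ∃ y ∈ A π,
      (cauchyRep ν).shift (projω (proj2 (nm π) 0) j) y := fun π => (hrange π).2.1
  choose pt hptA hpt using hex
  let g : P → ℕ × ℕ → ℕ := fun π x => nm π (2 * Nat.pair x.1 x.2) - 1
  have hg : CompFrom nm g :=
    (CompFrom.of_primrec (f := fun n : ℕ => n - 1) (by fun_prop)).comp
      (CompFrom.entry.comp (CompFrom.of_primrec (f := fun x : ℕ × ℕ => 2 * Nat.pair x.1 x.2)
        (by fun_prop)))
  have hshift : ∀ (π : P) j y, (cauchyRep ν).shift (projω (proj2 (nm π) 0) j) y →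
      cauchyRep ν (fun k => g π (j, k)) y := by
    rintro π j y ⟨p, hp, hy⟩
    have : (fun k => g π (j, k)) = p := by
      funext k
      have := hp k
      simp only [projω, proj2, add_zero] at this
      simp [g, this]
    rwa [this]
  have hgpt : ∀ π j, cauchyRep ν (fun k => g π (j, k)) (pt π j) := fun π j =>
    hshift π j _ (hpt π j)
  have hdense : ∀ π, (A π : Set X) ⊆ closure (Set.range (pt π)) := by
    intro π x hx
    rw [mem_closure_iff]
    intro U hU hxU
    obtain ⟨j, y, hyU, hy⟩ := (hrange π).2.2 x hx U hU hxU
    -- A name determines its point, so the density stated for named points transfers to the chosen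
    -- ones.
    have : y = pt π j := tendsto_nhds_unique (hshift π j y hy).2 (hgpt π j).2
    exact ⟨y, hyU, j, this.symm⟩
  have hd : LowerSemi nm fun π a => Metric.infDist (ν a) (A π : Set X) :=
    lowerSemi_infDist hA' (g := fun π => proj2 (nm π) 1)
      (CompFrom.entry.comp (CompFrom.of_primrec (f := fun n : ℕ => 2 * n + 1) (by fun_prop)))
      fun π => π.2.2.2
  obtain ⟨b, hb, hbA⟩ := exists_enumeration_smallBall hν.1 hA hd
  obtain ⟨J, hJ, hJA⟩ := exists_selection hν hA' hd hg hgpt hdense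
  obtain ⟨e, he, heb⟩ := exists_names_refinement hν hb
  obtain ⟨t, ht, htb⟩ := exists_cover_refinement hν hb
  have hs : CompFrom nm fun π (x : ℕ × ℕ) => g π (J π (b π x.1), x.2) :=
    hg.comp (((hJ.comp hb).comp (CompFrom.of_primrec (by fun_prop))).pair
      (CompFrom.of_primrec (by fun_prop)))
  exact Rep.Reducible.of_compFrom (he.assembleName ht hs) fun π => ⟨hA π,
    delta4_assembleName hν.1 (hA' π) (hbA π) (fun n => hptA π (J π (b π n)))
      (fun n => hJA π (b π n)) (heb π) (htb π) fun n => hgpt π (J π (b π n))⟩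

end Construction

end Dugundji

theorem mainTheorem9 {X : Type*} [MetricSpace X] (ν : ℕ → X)
    (hν : Dugundji.IsComputableMetricSpace ν) :
    Dugundji.Rep.Reducible
        (((Dugundji.rangeRep ν).meet (Dugundji.distRep ν)).restrict (Dugundji.properClosed X))
        ((Dugundji.delta4 ν).restrict (Dugundji.properClosed X)) ∧
      Dugundji.Rep.Reducible
        ((Dugundji.delta4 ν).restrict (Dugundji.properClosed X))
        ((Dugundji.delta8 ν).restrict (Dugundji.properClosed X)) :=
  ⟨Dugundji.range_dist_reducible_delta4 hν, Dugundji.delta4_reducible_delta8 ν⟩
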